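/- For integers $n, r \ge 0$ write $\binom{n}{\downarrow r} = \sum_{i=0}^{\lfloor r\rfloor}\binom{n}{i}$ (also for half-integers $r$). There are a deterministic algorithm (one fixed program for a random access machine in which every operation is charged the bit length of the numbers and addresses it handles) and constants $C, d$ such that the following holds for all integers $k \ge 1$, $n \ge 0$. Given (by adjacency matrices) a tree $T$ on $k$ nodes and a finite simple graph $G$ on $n$ vertices, the algorithm outputs the exact number of (not necessarily induced) copies of $T$ in $G$, that is, the number of subgraphs of $G$ isomorphic to $T$, in time at most $$C\,(n+k+1)^{d}\binom{n}{\downarrow k/2}.$$ In other words, the number of copies of $T$ in $G$ can be counted deterministically in time $O^*\!\left(\binom{n}{\downarrow k/2}\right)$, where $O^*$ suppresses factors polynomial in $n$ and $k$. -/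

import Mathlib

/-! ### Random access machine with logarithmic cost

The machine has registers and arrays (named by numerals in the program, so a program uses only
finitely many of each) whose cells hold natural numbers of arbitrary size. Programs are
deterministic and structured. Every operation is charged the bit length of all the numbers it
handles, addresses included. -/

namespace RAM

/-- Memory of the machine: `reg x` is the content of register `x`, and `arr a i` is the content of
cell `i` of array `a`. -/
structure State where
  reg : ℕ → ℕ
  arr : ℕ → ℕ → ℕ

/-- Assign a value to a register. -/
def State.setReg (s : State) (x v : ℕ) : State :=
  { s with reg := Function.update s.reg x v }

/-- Write a value into cell `i` of array `a`. -/
def State.setArr (s : State) (a i v : ℕ) : State :=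
  { s with arr := Function.update s.arr a (Function.update (s.arr a) i v) }

/-- Elementary arithmetic operations; subtraction is truncated at `0`, and division is rounded
down. -/
inductive Op where
  | add | sub | mul | div

def Op.apply : Op → ℕ → ℕ → ℕ
  | .add, x, y => x + y
  | .sub, x, y => x - y
  | .mul, x, y => x * y
  | .div, x, y => x / y

/-- Logarithmic size of a number: its number of binary digits, plus one. -/
def len (v : ℕ) : ℕ := Nat.size v + 1

/-- Expressions: numerals, registers, array cells (with computed index), and operations. -/
inductive Expr where
  | lit (c : ℕ)
  | reg (x : ℕ)
  | get (a : ℕ) (i : Expr)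
  | op (o : Op) (e₁ e₂ : Expr)

/-- Value of an expression. -/
def Expr.val (s : State) : Expr → ℕ
  | .lit c => c
  | .reg x => s.reg x
  | .get a i => s.arr a (i.val s)
  | .op o e₁ e₂ => o.apply (e₁.val s) (e₂.val s)

/-- Time for evaluating an expression. -/
def Expr.cost (s : State) : Expr → ℕ
  | .lit c => len c
  | .reg x => len (s.reg x)
  | .get a i => i.cost s + len (i.val s) + len (s.arr a (i.val s))
  | .op _ e₁ e₂ => e₁.cost s + e₂.cost s + len (e₁.val s) + len (e₂.val s)

/-- Programs. -/
inductive Prog where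
  | skip
  | assign (x : ℕ) (e : Expr)
  | store (a : ℕ) (i e : Expr)
  | seq (p q : Prog)
  | cond (e : Expr) (p q : Prog)
  | loop (e : Expr) (p : Prog)

/-- `Exec p s t s'`: the program `p`, started in the state `s`, halts after time exactly `t` in the
state `s'`. The test of `cond` and of `loop` (a while loop) is whether the value is nonzero. -/
inductive Exec : Prog → State → ℕ → State → Prop
  | skip (s : State) : Exec .skip s 1 s
  | assign (s : State) (x : ℕ) (e : Expr) :
      Exec (.assign x e) s (e.cost s + len (e.val s)) (s.setReg x (e.val s))
  | store (s : State) (a : ℕ) (i e : Expr) :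
      Exec (.store a i e) s (i.cost s + e.cost s + len (i.val s) + len (e.val s))
        (s.setArr a (i.val s) (e.val s))
  | seq {p q : Prog} {s s₁ s₂ : State} {t₁ t₂ : ℕ} (hp : Exec p s t₁ s₁) (hq : Exec q s₁ t₂ s₂) :
      Exec (.seq p q) s (t₁ + t₂) s₂
  | cond_true {e : Expr} {p q : Prog} {s s' : State} {t : ℕ} (he : e.val s ≠ 0)
      (hp : Exec p s t s') : Exec (.cond e p q) s (e.cost s + len (e.val s) + t) s'
  | cond_false {e : Expr} {p q : Prog} {s s' : State} {t : ℕ} (he : e.val s = 0)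
      (hq : Exec q s t s') : Exec (.cond e p q) s (e.cost s + len (e.val s) + t) s'
  | loop_done {e : Expr} {p : Prog} {s : State} (he : e.val s = 0) :
      Exec (.loop e p) s (e.cost s + len (e.val s)) s
  | loop_step {e : Expr} {p : Prog} {s s₁ s₂ : State} {t₁ t₂ : ℕ} (he : e.val s ≠ 0)
      (hp : Exec p s t₁ s₁) (hl : Exec (.loop e p) s₁ t₂ s₂) :
      Exec (.loop e p) s (e.cost s + len (e.val s) + t₁ + t₂) s₂

open Classical in
/-- The adjacency matrix of a graph on `Fin m`, written row by row into an array: cell `u * m + v`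
holds `1` if `u` and `v` are adjacent, and all other cells hold `0`. -/
noncomputable def adjTable {m : ℕ} (H : SimpleGraph (Fin m)) (p : ℕ) : ℕ :=
  if ∃ u v : Fin m, H.Adj u v ∧ p = (u : ℕ) * m + (v : ℕ) then 1 else 0

/-- The initial state for the input `(T, G)`: register `0` holds the number `k` of nodes of `T`,
register `1` holds the number `n` of vertices of `G`, array `0` holds the adjacency matrix of `T`,
array `1` that of `G`; all other memory is zero. -/
noncomputable def graphPairInput {k n : ℕ} (T : SimpleGraph (Fin k)) (G : SimpleGraph (Fin n)) :
    State where
  reg x := if x = 0 then k else if x = 1 then n else 0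
  arr a := if a = 0 then adjTable T else if a = 1 then adjTable G else fun _ => 0

end RAM

/-- `binom(n, ↓r)`: the number of subsets of size at most `r` of an `n`-element set. -/
def downChoose (n r : ℕ) : ℕ := ∑ i ∈ Finset.range (r + 1), n.choose i

/-! Encode a set of vertices of `G` as a mask `x < 2 ^ n`, and give vertex `v` the weight `-1` if it
lies in the mask and `1` otherwise. Fix a map `φ` from the nodes of `T` to the vertices of `G`, and
let `j` be the number of vertices with an odd number of preimages. Summing `(-X) ^ |x|` times the
product of the weights along `φ` over all masks gives `(1 - X) ^ (n - j) * (1 + X) ^ j`. Here `j ≤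
k`, `j ≡ k` modulo 2, and `j = k` exactly when `φ` is injective (`odd_fibers_card`). A suitable
power series multiplier makes the coefficient of `X ^ (k / 2)` equal to `4 ^ (k / 2)` for `j = k`
and `0` for every other admissible `j` (`coeff_maskWeight_mul`). That coefficient involves only
masks with at most `k / 2` ones. Summed over all homomorphisms, it gives `4 ^ (k / 2)` times the
number of injective ones (`maskSum_neg_one`).

For a fixed mask the weighted sum over homomorphisms is computable in polynomial time because `T` is
a tree: leaves are removed one by one and absorbed into their neighbours
(`restrictedSum_eliminate`). The machine has no negative numbers, so `M - 1` replaces `-1` and the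
result is reduced modulo a large `M` (`maskSum_mod`); intermediate numbers are left unreduced but
have only polynomially many bits (`fits`, `maskSum_lt`).

The masks are visited in increasing order, and blocks of masks that have too many ones are jumped
over. Every visited mask has at most `k / 2 + 1` ones, which costs only a factor `n + 1` over
`downChoose n (k / 2)` (`processMask_spec`, `sumMasks_spec`). Finally, injective homomorphisms
overcount subgraphs by the number of automorphisms of `T` (`labelledCopyCount_eq_copyCount_mul`).
That number comes from running the same procedure with `T` as host graph, and one division finishes.
-/

open Finset

/-! ### Subsets of the vertex set as binary numbers -/

/-- The number of ones in the binary expansion of a number. -/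
def binaryOnes : ℕ → ℕ
  | 0 => 0
  | x + 1 => (x + 1) % 2 + binaryOnes ((x + 1) / 2)
decreasing_by omega

lemma binaryOnes_eq (x : ℕ) : binaryOnes x = x % 2 + binaryOnes (x / 2) := by
  cases x with
  | zero => simp [binaryOnes]
  | succ x => rw [binaryOnes]

lemma sum_bits_eq_binaryOnes (n x : ℕ) (hx : x < 2 ^ n) :
    ∑ v ∈ range n, x / 2 ^ v % 2 = binaryOnes x := by
  induction n generalizing x with
  | zero =>
    obtain rfl : x = 0 := by simpa using hx
    simp [binaryOnes]
  | succ n ih =>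
    rw [sum_range_succ', binaryOnes_eq, ← ih (x / 2) (by rw [pow_succ] at hx; omega)]
    simp [pow_succ', Nat.div_div_eq_div_mul, add_comm]

lemma binaryOnes_le_of_lt_two_pow {n x : ℕ} (hx : x < 2 ^ n) : binaryOnes x ≤ n := by
  rw [← sum_bits_eq_binaryOnes n x hx]
  calc _ ≤ ∑ _v ∈ range n, 1 := sum_le_sum fun v _ => by omega
    _ = n := by simp

lemma binaryOnes_succ_le (x : ℕ) : binaryOnes (x + 1) ≤ binaryOnes x + 1 := by
  induction x using Nat.strong_induction_on with
  | _ x ih =>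
    rw [binaryOnes_eq (x + 1), binaryOnes_eq x]
    rcases Nat.mod_two_eq_zero_or_one x with h | h
    · rw [show (x + 1) / 2 = x / 2 by omega]; omega
    · rw [show (x + 1) / 2 = x / 2 + 1 by omega]
      have := ih (x / 2) (by omega)
      omega

/-- The digits of `s` occupy the positions that the shift of `q` leaves free. Hence no number in the
block of length `2 ^ e` starting at `q * 2 ^ e` has fewer ones than `q`, which justifies skipping
such a block. -/
lemma binaryOnes_mul_two_pow_add (q e s : ℕ) (hs : s < 2 ^ e) :
    binaryOnes (q * 2 ^ e + s) = binaryOnes q + binaryOnes s := by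
  induction e generalizing s with
  | zero =>
    obtain rfl : s = 0 := by simpa using hs
    simp [binaryOnes]
  | succ e ih =>
    rw [pow_succ] at *
    rw [binaryOnes_eq, binaryOnes_eq s,
      show (q * (2 ^ e * 2) + s) / 2 = q * 2 ^ e + s / 2 by rw [← mul_assoc]; omega,
      ih _ (by omega), show (q * (2 ^ e * 2) + s) % 2 = s % 2 by rw [← mul_assoc]; omega]
    omega

/-- The last one disappears and the carry creates at most one new one. -/
lemma binaryOnes_succ_le_of_odd {q : ℕ} (hq : q % 2 = 1) : binaryOnes (q + 1) ≤ binaryOnes q := by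
  rw [binaryOnes_eq (q + 1), binaryOnes_eq q, show (q + 1) / 2 = q / 2 + 1 by omega]
  have := binaryOnes_succ_le (q / 2)
  omega

lemma sum_range_two_mul {R : Type*} [AddCommMonoid R] (f : ℕ → R) (n : ℕ) :
    ∑ x ∈ range (2 * n), f x = ∑ x ∈ range n, (f (2 * x) + f (2 * x + 1)) := by
  induction n with
  | zero => simp
  | succ n ih => rw [show 2 * (n + 1) = 2 * n + 1 + 1 by ring, sum_range_succ, sum_range_succ, ih,
      sum_range_succ _ n, add_assoc]

/-- Expanding the product means choosing a subset of the factors. The induction splits off the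
lowest binary digit. -/
lemma sum_masks_prod {R : Type*} [CommSemiring R] (n : ℕ) (t : ℕ → R) :
    ∑ x ∈ range (2 ^ n), ∏ v ∈ range n, (if x / 2 ^ v % 2 = 1 then t v else 1) =
      ∏ v ∈ range n, (1 + t v) := by
  induction n generalizing t with
  | zero => simp
  | succ n ih =>
    rw [pow_succ', sum_range_two_mul, prod_range_succ', ← ih, sum_mul]
    refine sum_congr rfl fun x _ => ?_
    rw [prod_range_succ', prod_range_succ']
    have h1 : ∀ v, 2 * x / 2 ^ (v + 1) = x / 2 ^ v := fun v => by
      rw [pow_succ', ← Nat.div_div_eq_div_mul]; congr 1; omega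
    have h2 : ∀ v, (2 * x + 1) / 2 ^ (v + 1) = x / 2 ^ v := fun v => by
      rw [pow_succ', ← Nat.div_div_eq_div_mul]; congr 1; omega
    simp only [h1, h2, pow_zero, Nat.div_one]
    rw [if_neg (by omega), if_pos (by omega), mul_add]

lemma prod_bits_pow {R : Type*} [CommSemiring R] (n x : ℕ) (hx : x < 2 ^ n) (c : R) :
    ∏ v ∈ range n, (if x / 2 ^ v % 2 = 1 then c else 1) = c ^ binaryOnes x := by
  rw [← sum_bits_eq_binaryOnes n x hx, ← prod_pow_eq_pow_sum]
  refine prod_congr rfl fun v _ => ?_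
  rcases Nat.mod_two_eq_zero_or_one (x / 2 ^ v) with h | h <;> simp [h]

/-- Put `X` for every `t v` in `sum_masks_prod` and compare coefficients with the binomial theorem.
-/
lemma card_binaryOnes_eq (n i : ℕ) :
    #{x ∈ range (2 ^ n) | binaryOnes x = i} = n.choose i := by
  have h := sum_masks_prod n (fun _ => (Polynomial.X : Polynomial ℕ))
  rw [sum_congr rfl fun x hx => prod_bits_pow n x (mem_range.1 hx) Polynomial.X] at h
  have h' := congrArg (fun p => Polynomial.coeff p i) h
  simp only [Polynomial.finsetSum_coeff, Polynomial.coeff_X_pow, prod_const, card_range,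
    Polynomial.coeff_one_add_X_pow] at h'
  rw [card_filter]
  simpa [eq_comm] using h'

lemma card_binaryOnes_le (n r : ℕ) :
    #{x ∈ range (2 ^ n) | binaryOnes x ≤ r} = downChoose n r := by
  rw [downChoose, card_eq_sum_card_fiberwise (f := binaryOnes) (t := range (r + 1))]
  · refine sum_congr rfl fun i hi => ?_
    rw [← card_binaryOnes_eq, filter_filter]
    congr 1
    ext x
    simp only [mem_filter, mem_range] at *
    constructor
    · rintro ⟨h, -, h'⟩; exact ⟨h, h'⟩
    · rintro ⟨h, h'⟩; exact ⟨h, by omega, h'⟩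
  · intro x hx
    simp at hx ⊢
    omega

lemma downChoose_pos (n r : ℕ) : 0 < downChoose n r := by
  rw [downChoose, sum_range_succ']
  simp

/-- Consecutive binomial coefficients differ by a factor of at most `n`. This pays for visiting
masks with one element more than needed. -/
lemma downChoose_succ_le (n r : ℕ) : downChoose n (r + 1) ≤ (n + 1) * downChoose n r := by
  have h : n.choose (r + 1) ≤ n * n.choose r := by
    have := Nat.choose_succ_right_eq n r
    calc n.choose (r + 1) ≤ n.choose (r + 1) * (r + 1) := Nat.le_mul_of_pos_right _ (by omega)
      _ = n.choose r * (n - r) := this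
      _ ≤ n.choose r * n := Nat.mul_le_mul_left _ (by omega)
      _ = n * n.choose r := mul_comm _ _
  have h2 : n.choose r ≤ downChoose n r :=
    single_le_sum (f := fun i => n.choose i) (fun _ _ => Nat.zero_le _) (mem_range.2 (by omega))
  rw [downChoose, sum_range_succ, ← downChoose]
  nlinarith

lemma downChoose_mono_left {m n : ℕ} (h : m ≤ n) (r : ℕ) : downChoose m r ≤ downChoose n r :=
  sum_le_sum fun _ _ => Nat.choose_le_choose _ h

/-! ### The weights -/

/-- Coefficients of the power series `(1 + X) / (1 - X) ^ (n + 1 - k)` for even `k`, and of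
`1 / (1 - X) ^ (n + 1 - k)` for odd `k`. -/
def maskWeight (n k r : ℕ) : ℕ :=
  (n - k + r).choose r + (1 - k % 2) * (if r = 0 then 0 else (n - k + (r - 1)).choose (r - 1))

-- The form in which the weights are used: the denominator cancels against powers of `1 - X`, and
-- the extra factor `1 + X` for even `k` corrects the parity of the degree.
open PowerSeries in
lemma mk_maskWeight (n k : ℕ) :
    (mk fun r => (maskWeight n k r : ℤ)) =
      (1 + ((1 - k % 2 : ℕ) : ℤ⟦X⟧) * X) * (invOneSubPow ℤ (n - k + 1)).val := by
  rw [invOneSubPow_val_succ_eq_mk_add_choose, add_mul, one_mul, mul_assoc]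
  ext r
  rw [map_add, show ((1 - k % 2 : ℕ) : ℤ⟦X⟧) = C ((1 - k % 2 : ℕ) : ℤ) by simp, coeff_C_mul]
  cases r with
  | zero => simp [maskWeight]
  | succ r =>
    rw [coeff_succ_X_mul]
    simp only [coeff_mk, maskWeight]
    rw [if_neg (by omega), Nat.add_sub_cancel, Nat.choose_symm_add, Nat.choose_symm_add]
    push_cast
    ring

-- Reversing coefficients fixes `1 + X` and negates `1 - X`. Since `a` is odd, the product of formal
-- degree `2 * h` is antipalindromic, and its middle coefficient is its own negative.
open Polynomial in
lemma coeff_middle_eq_zero (a b h : ℕ) (ha : Odd a) (hab : a + b = 2 * h) :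
    ((1 - X) ^ a * (1 + X) ^ b : ℤ[X]).coeff h = 0 := by
  have hr1 : reflect 1 (1 - X : ℤ[X]) = -(1 - X) := by
    rw [reflect_sub, reflect_one, ← pow_one (X : ℤ[X]), reflect_monomial]; simp
  have hr2 : reflect 1 (1 + X : ℤ[X]) = 1 + X := by
    rw [reflect_add, reflect_one, ← pow_one (X : ℤ[X]), reflect_monomial]; simp [add_comm]
  have hd1 : (1 - X : ℤ[X]).natDegree ≤ 1 := by compute_degree
  have hd2 : (1 + X : ℤ[X]).natDegree ≤ 1 := by compute_degree
  have hpow : ∀ (p : ℤ[X]) (m : ℕ), p.natDegree ≤ 1 → reflect m (p ^ m) = (reflect 1 p) ^ m := by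
    intro p m hp
    induction m with
    | zero => simp
    | succ m ih =>
      rw [pow_succ, reflect_mul _ _ (natDegree_pow_le_of_le m hp |>.trans (by simp)) hp, ih, pow_succ]
  have key : reflect (2 * h) ((1 - X) ^ a * (1 + X) ^ b : ℤ[X]) = -((1 - X) ^ a * (1 + X) ^ b) := by
    rw [← hab, reflect_mul _ _ (natDegree_pow_le_of_le a hd1 |>.trans (by simp))
      (natDegree_pow_le_of_le b hd2 |>.trans (by simp)), hpow _ _ hd1, hpow _ _ hd2, hr1, hr2,
      ha.neg_pow, neg_mul]
  have := congrArg (fun p => coeff p h) key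
  simp only [coeff_reflect, coeff_neg] at this
  rw [revAt_le (by omega), show 2 * h - h = h by omega] at this
  omega

-- For `j = k` the product is `(1 + X) ^ (2 * (k / 2) + 1) / (1 - X)`, whose coefficient is the sum
-- of half a row of Pascal's triangle. For `j < k` the denominator cancels, leaving a polynomial of
-- degree `2 * (k / 2)` in which `1 - X` has the odd exponent `k - 1 - j`; its middle coefficient
-- vanishes.
open PowerSeries in
lemma coeff_maskWeight_mul (n k j : ℕ) (hkn : k ≤ n) (hj : j ≤ k) (hpar : j % 2 = k % 2) :
    coeff (k / 2) ((mk fun r => (maskWeight n k r : ℤ)) * ((1 - X) ^ (n - j) * (1 + X) ^ j)) =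
      if j = k then 4 ^ (k / 2) else 0 := by
  rw [mk_maskWeight]
  have hinv : (invOneSubPow ℤ (n - k + 1)).val * (1 - X) ^ (n - k + 1) = 1 := by
    rw [← invOneSubPow_inv_eq_one_sub_pow]; simp
  split_ifs with h
  · subst h
    have h1 : (1 + ((1 - j % 2 : ℕ) : ℤ⟦X⟧) * X) * (1 + X) ^ j = (1 + X) ^ (2 * (j / 2) + 1) := by
      rcases Nat.mod_two_eq_zero_or_one j with h | h
      · rw [h]
        nth_rewrite 1 [show j = 2 * (j / 2) by omega]
        simp; ring
      · rw [h]
        nth_rewrite 1 [show j = 2 * (j / 2) + 1 by omega]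
        simp
    have h2 : (invOneSubPow ℤ (n - j + 1)).val * (1 - X) ^ (n - j) = (mk 1 : ℤ⟦X⟧) := by
      have h3 : (mk 1 : ℤ⟦X⟧) * (1 - X) = 1 := mk_one_mul_one_sub_eq_one ℤ
      calc _ = (invOneSubPow ℤ (n - j + 1)).val * (1 - X) ^ (n - j) * ((PowerSeries.mk 1 : ℤ⟦X⟧) * (1 - X)) := by
            rw [h3, mul_one]
        _ = ((invOneSubPow ℤ (n - j + 1)).val * (1 - X) ^ (n - j + 1)) * PowerSeries.mk 1 := by ring
        _ = _ := by rw [hinv, one_mul]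
    rw [show (1 + ((1 - j % 2 : ℕ) : ℤ⟦X⟧) * X) * (invOneSubPow ℤ (n - j + 1)).val *
        ((1 - X) ^ (n - j) * (1 + X) ^ j) =
        ((1 + ((1 - j % 2 : ℕ) : ℤ⟦X⟧) * X) * (1 + X) ^ j) *
        ((invOneSubPow ℤ (n - j + 1)).val * (1 - X) ^ (n - j)) by ring, h1, h2, coeff_mul,
      Nat.sum_antidiagonal_eq_sum_range_succ_mk]
    have h4 := Nat.sum_range_choose_halfway (j / 2)
    rw [show (4 : ℤ) ^ (j / 2) = ((4 ^ (j / 2) : ℕ) : ℤ) by push_cast; rfl, ← h4]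
    push_cast
    refine sum_congr rfl fun i _ => ?_
    rw [coeff_mk, Pi.one_apply, mul_one,
      show ((1 + X) ^ (2 * (j / 2) + 1) : ℤ⟦X⟧) =
        (((1 + Polynomial.X) ^ (2 * (j / 2) + 1) : Polynomial ℤ) : ℤ⟦X⟧) by simp,
      Polynomial.coeff_coe, Polynomial.coeff_one_add_X_pow]
  · have hjk : j < k := by omega
    have e1 : (1 - X : ℤ⟦X⟧) ^ (n - j) = (1 - X) ^ (n - k + 1) * (1 - X) ^ (k - 1 - j) := by
      rw [← pow_add]; congr 1; omega
    rw [show (1 + ((1 - k % 2 : ℕ) : ℤ⟦X⟧) * X) * (invOneSubPow ℤ (n - k + 1)).val *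
        ((1 - X) ^ (n - j) * (1 + X) ^ j) =
        ((invOneSubPow ℤ (n - k + 1)).val * (1 - X) ^ (n - k + 1)) *
        ((1 - X) ^ (k - 1 - j) * ((1 + X) ^ j * (1 + ((1 - k % 2 : ℕ) : ℤ⟦X⟧) * X))) by
        rw [e1]; ring, hinv, one_mul]
    have h1 : (1 + X) ^ j * (1 + ((1 - k % 2 : ℕ) : ℤ⟦X⟧) * X) = (1 + X) ^ (j + (1 - k % 2)) := by
      rcases Nat.mod_two_eq_zero_or_one k with h | h <;> rw [h] <;> simp [pow_succ]
    rw [h1]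
    have h2 := coeff_middle_eq_zero (k - 1 - j) (j + (1 - k % 2)) (k / 2)
      (Nat.odd_iff.2 (by omega)) (by omega)
    rw [← h2, ← Polynomial.coeff_coe]
    simp

/-! ### Weighted homomorphism sums and labelled copies -/

open Classical in
/-- The sum over all homomorphisms `φ` from `T` to `G` of `∏ u, w (φ u)`. -/
noncomputable def homSum {R : Type*} [CommSemiring R] {k n : ℕ} (T : SimpleGraph (Fin k))
    (G : SimpleGraph (Fin n)) (w : ℕ → R) : R :=
  ∑ φ : Fin k → Fin n, if ∀ u v, T.Adj u v → G.Adj (φ u) (φ v) then ∏ u, w (φ u) else 0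

/-- The signed sum over the masks with at most `k / 2` ones, where `q` stands for `-1`. -/
noncomputable def maskSum {R : Type*} [CommSemiring R] {k n : ℕ} (T : SimpleGraph (Fin k))
    (G : SimpleGraph (Fin n)) (q : R) : R :=
  ∑ x ∈ range (2 ^ n), if binaryOnes x ≤ k / 2 then
    q ^ binaryOnes x * (maskWeight n k (k / 2 - binaryOnes x) : R) *
      homSum T G (fun v => if x / 2 ^ v % 2 = 1 then q else 1) else 0

lemma map_homSum {R S : Type*} [CommSemiring R] [CommSemiring S] (f : R →+* S) {k n : ℕ}
    (T : SimpleGraph (Fin k)) (G : SimpleGraph (Fin n)) (w : ℕ → R) :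
    f (homSum T G w) = homSum T G (fun v => f (w v)) := by
  simp only [homSum, map_sum, apply_ite f, map_prod, map_zero]

lemma map_maskSum {R S : Type*} [CommSemiring R] [CommSemiring S] (f : R →+* S) {k n : ℕ}
    (T : SimpleGraph (Fin k)) (G : SimpleGraph (Fin n)) (q : R) :
    f (maskSum T G q) = maskSum T G (f q) := by
  simp only [maskSum, map_sum, apply_ite f, map_mul, map_pow, map_natCast, map_zero, map_homSum,
    map_one]

/-- The fibre sizes add up to `k`, and their residues modulo 2 add up to the number of odd fibres.
Comparing termwise, equality forces every fibre to have at most one element. -/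
lemma odd_fibers_card {k n : ℕ} (φ : Fin k → Fin n) :
    #{v | Odd #{u | φ u = v}} ≤ k ∧ #{v | Odd #{u | φ u = v}} % 2 = k % 2 ∧
      (#{v | Odd #{u | φ u = v}} = k ↔ Function.Injective φ) := by
  have hc : #{v | Odd #{u | φ u = v}} = ∑ v, #{u | φ u = v} % 2 := by
    rw [card_filter]
    refine sum_congr rfl fun v _ => ?_
    split_ifs with h
    · exact (Nat.odd_iff.1 h).symm
    · exact (Nat.even_iff.1 (Nat.not_odd_iff_even.1 h)).symm
  have hk : k = ∑ v, #{u | φ u = v} := by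
    have := card_eq_sum_card_fiberwise (f := φ) (s := univ) (t := univ) (by simp)
    simpa using this
  refine ⟨?_, ?_, ?_⟩
  · rw [hc]; conv_rhs => rw [hk]
    exact sum_le_sum fun v _ => Nat.mod_le _ _
  · rw [hc]; conv_rhs => rw [hk]
    rw [Finset.sum_nat_mod univ 2 (fun v => #{u | φ u = v})]
  · rw [hc]
    constructor
    · intro h
      have h2 : ∑ v, #{u | φ u = v} % 2 = ∑ v, #{u | φ u = v} := h.trans hk
      rw [sum_eq_sum_iff_of_le fun v _ => Nat.mod_le _ _] at h2
      intro a b hab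
      have h3 : #{u | φ u = φ b} ≤ 1 := by have := h2 (φ b) (mem_univ _); omega
      exact card_le_one.1 h3 a (by simp [hab]) b (by simp)
    · intro h
      conv_rhs => rw [hk]
      refine sum_congr rfl fun v _ => Nat.mod_eq_of_lt ?_
      refine Nat.lt_succ_of_le (card_le_one.2 fun a ha b hb => h ?_)
      simp at ha hb
      rw [ha, hb]

-- For a fixed `φ` the sum is one coefficient of the product of two series: the weights, and the
-- generating function of signed masks by size. The latter factors over the vertices, an odd fibre
-- contributing `1 + X` and an even one `1 - X`.
open PowerSeries in
lemma signed_masks_map {k n : ℕ} (hkn : k ≤ n) (φ : Fin k → Fin n) :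
    ∑ x ∈ range (2 ^ n), (if binaryOnes x ≤ k / 2 then
      (-1 : ℤ) ^ binaryOnes x * (maskWeight n k (k / 2 - binaryOnes x) : ℤ) *
        ∏ u, (if x / 2 ^ (φ u : ℕ) % 2 = 1 then -1 else 1) else 0) =
      if Function.Injective φ then 4 ^ (k / 2) else 0 := by
  obtain ⟨h1, h2, h3⟩ := odd_fibers_card φ
  rw [← if_congr h3 rfl rfl, ← coeff_maskWeight_mul n k _ hkn h1 h2]
  set c : Fin n → ℕ := fun v => #{u | φ u = v} with hc
  have hprod : ∏ v : Fin n, (1 + -(X * C ((-1 : ℤ) ^ c v))) =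
      (1 - X : ℤ⟦X⟧) ^ (n - #{v | Odd (c v)}) * (1 + X) ^ #{v | Odd (c v)} := by
    have h4 : ∀ v, (1 + -(X * C ((-1 : ℤ) ^ c v)) : ℤ⟦X⟧) =
        if Odd (c v) then 1 + X else 1 - X := by
      intro v
      split_ifs with h
      · rw [h.neg_one_pow]; simp
      · rw [(Nat.not_odd_iff_even.1 h).neg_one_pow]; simp [sub_eq_add_neg]
    rw [prod_congr rfl fun v _ => h4 v, prod_ite, prod_const, prod_const, mul_comm]
    congr 2
    have := card_filter_add_card_filter_not (s := (univ : Finset (Fin n))) (fun v => Odd (c v))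
    rw [card_univ, Fintype.card_fin] at this
    omega
  have hsum : (1 - X : ℤ⟦X⟧) ^ (n - #{v | Odd (c v)}) * (1 + X) ^ #{v | Odd (c v)} =
      ∑ x ∈ range (2 ^ n), C ((-1 : ℤ) ^ binaryOnes x *
        ∏ u, (if x / 2 ^ (φ u : ℕ) % 2 = 1 then -1 else 1)) * X ^ binaryOnes x := by
    rw [← hprod]
    -- The default value is never used; the extension only turns products over `Fin n` into products
    -- over `range n`.
    let c' : ℕ → ℕ := fun v => if h : v < n then c ⟨v, h⟩ else 0
    have hc' : ∀ v : Fin n, c v = c' v := fun v => by simp [c']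
    rw [Fintype.prod_congr _ _ (fun v => by rw [hc' v]),
      ← Finset.prod_range (fun v => 1 + -(X * C ((-1 : ℤ) ^ c' v))), ← sum_masks_prod]
    refine sum_congr rfl fun x hx => ?_
    have h5 : ∏ u, (if x / 2 ^ (φ u : ℕ) % 2 = 1 then (-1 : ℤ) else 1) =
        ∏ v ∈ range n, (if x / 2 ^ v % 2 = 1 then (-1 : ℤ) ^ c' v else 1) := by
      -- Group the nodes by their image. Vertices outside the image have an empty fibre and
      -- contribute `1`.
      rw [Finset.prod_range, Finset.prod_comp (fun v : Fin n => if x / 2 ^ (v : ℕ) % 2 = 1 then (-1 : ℤ) else 1) φ]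
      rw [prod_subset (subset_univ _)]
      · refine prod_congr rfl fun v _ => ?_
        rw [← hc']
        split_ifs <;> simp [hc]
      · intro v _ hv
        have : #{u | φ u = v} = 0 := by
          rw [card_eq_zero, filter_eq_empty_iff]
          intro u _ hu
          exact hv (hu ▸ mem_image_of_mem _ (mem_univ _))
        rw [this, pow_zero]
    rw [h5, ← prod_bits_pow n x (mem_range.1 hx), ← prod_bits_pow n x (mem_range.1 hx),
      ← prod_mul_distrib, map_prod, ← prod_mul_distrib]
    refine prod_congr rfl fun v _ => ?_
    split_ifs <;> simp [mul_comm]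
  rw [hsum, mul_sum, map_sum]
  refine sum_congr rfl fun x _ => ?_
  rw [mul_left_comm, coeff_C_mul, coeff_mul_X_pow']
  split_ifs
  · rw [coeff_mk]; ring
  · simp

lemma labelledCopyCount_eq_nat_card {k n : ℕ} (T : SimpleGraph (Fin k))
    (G : SimpleGraph (Fin n)) : G.labelledCopyCount T = Nat.card (T.Copy G) := by
  rw [SimpleGraph.labelledCopyCount, Fintype.card_eq_nat_card]

lemma labelledCopyCount_eq_card {k n : ℕ} (T : SimpleGraph (Fin k)) (G : SimpleGraph (Fin n)) :
    (G.labelledCopyCount T : ℤ) = ∑ φ : Fin k → Fin n,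
      open Classical in if (∀ u v, T.Adj u v → G.Adj (φ u) (φ v)) then
        (if Function.Injective φ then 1 else 0) else 0 := by
  classical
  simp_rw [← ite_and]
  rw [Finset.sum_boole, Nat.cast_inj, labelledCopyCount_eq_nat_card, ← Fintype.card_subtype,
    Fintype.card_eq_nat_card]
  refine Nat.card_congr ⟨fun f => ⟨f, fun u v h => f.toHom.map_adj h, f.injective⟩,
    fun f => ⟨⟨f.1, fun {u v} h => f.2.1 u v h⟩, f.2.2⟩, fun f => rfl, fun f => rfl⟩

theorem maskSum_neg_one {k n : ℕ} (hkn : k ≤ n) (T : SimpleGraph (Fin k))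
    (G : SimpleGraph (Fin n)) :
    maskSum T G (-1 : ℤ) = 4 ^ (k / 2) * G.labelledCopyCount T := by
  classical
  rw [labelledCopyCount_eq_card, mul_sum]
  simp only [maskSum, homSum, mul_sum, mul_ite, mul_zero, mul_one]
  have : ∀ x, (if binaryOnes x ≤ k / 2 then
      ∑ φ : Fin k → Fin n, (if ∀ u v, T.Adj u v → G.Adj (φ u) (φ v) then
        (-1 : ℤ) ^ binaryOnes x * (maskWeight n k (k / 2 - binaryOnes x) : ℤ) *
        ∏ u, (if x / 2 ^ (φ u : ℕ) % 2 = 1 then -1 else 1) else 0) else 0) =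
      ∑ φ : Fin k → Fin n, if ∀ u v, T.Adj u v → G.Adj (φ u) (φ v) then
        (if binaryOnes x ≤ k / 2 then
        (-1 : ℤ) ^ binaryOnes x * (maskWeight n k (k / 2 - binaryOnes x) : ℤ) *
        ∏ u, (if x / 2 ^ (φ u : ℕ) % 2 = 1 then -1 else 1) else 0) else 0 := by
    intro x
    by_cases h : binaryOnes x ≤ k / 2 <;> simp [h]
  rw [sum_congr rfl fun x _ => this x, sum_comm]
  refine sum_congr rfl fun φ _ => ?_
  split_ifs with h h'
  · rw [signed_masks_map hkn, if_pos h']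
  · rw [signed_masks_map hkn, if_neg h']
  · simp

/-- `maskSum` commutes with ring homomorphisms, and `M - 1` and `-1` agree in `ZMod M`. As `M`
exceeds the true value, the residue is that value. -/
theorem maskSum_mod {k n M : ℕ} (hkn : k ≤ n) (T : SimpleGraph (Fin k))
    (G : SimpleGraph (Fin n)) (hM : 4 ^ (k / 2) * G.labelledCopyCount T < M) :
    maskSum T G (M - 1) % M = 4 ^ (k / 2) * G.labelledCopyCount T := by
  rw [← Nat.mod_eq_of_lt hM]
  refine (ZMod.natCast_eq_natCast_iff' _ _ M).1 ?_
  have h := congrArg (Int.castRingHom (ZMod M)) (maskSum_neg_one hkn T G)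
  rw [map_maskSum] at h
  have h' := map_maskSum (Nat.castRingHom (ZMod M)) T G (M - 1)
  simp only [eq_natCast, eq_intCast] at h h'
  rw [h', Nat.cast_sub (by omega)]
  push_cast at h ⊢
  rw [← h]
  simp

/-! ### Labelled copies and the subgraphs they cover -/

lemma labelledCopyCount_le {k n : ℕ} (T : SimpleGraph (Fin k)) (G : SimpleGraph (Fin n)) :
    G.labelledCopyCount T ≤ n ^ k := by
  classical
  rw [labelledCopyCount_eq_nat_card]
  refine (Nat.card_le_card_of_injective (fun f : T.Copy G => (f : Fin k → Fin n))
    DFunLike.coe_injective).trans ?_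
  simp

/-- An injective endomorphism of a finite graph permutes its vertices and also its edges, so
composing with it does not change the image. -/
lemma toSubgraph_comp {k n : ℕ} {T : SimpleGraph (Fin k)} {G : SimpleGraph (Fin n)}
    (f : T.Copy G) (g : T.Copy T) : (f.comp g).toSubgraph = f.toSubgraph := by
  have hs : Function.Surjective g := Finite.surjective_of_injective g.injective
  have hE : Function.Surjective g.mapEdgeSet := Finite.surjective_of_injective g.mapEdgeSet.injective
  have hadj : ∀ u v, T.Adj u v → ∃ u' v', T.Adj u' v' ∧ g u' = u ∧ g v' = v := by
    intro u v h
    obtain ⟨⟨e, he⟩, h'⟩ := hE ⟨s(u, v), h⟩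
    induction e with
    | _ a b =>
      have h2 : s(g a, g b) = s(u, v) := congrArg Subtype.val h'
      rcases Sym2.eq_iff.1 h2 with ⟨h3, h4⟩ | ⟨h3, h4⟩
      · exact ⟨a, b, he, h3, h4⟩
      · exact ⟨b, a, (T.mem_edgeSet.1 he).symm, h4, h3⟩
  ext a b
  · simp only [SimpleGraph.Copy.toSubgraph, SimpleGraph.Subgraph.map_verts]
    constructor
    · rintro ⟨x, -, rfl⟩
      exact ⟨g x, trivial, rfl⟩
    · rintro ⟨x, -, rfl⟩
      obtain ⟨y, rfl⟩ := hs x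
      exact ⟨y, trivial, rfl⟩
  · simp only [SimpleGraph.Copy.toSubgraph, SimpleGraph.Subgraph.map_adj, Relation.Map]
    constructor
    · rintro ⟨x, y, h, rfl, rfl⟩
      exact ⟨g x, g y, g.toHom.map_adj h, rfl, rfl⟩
    · rintro ⟨x, y, h, rfl, rfl⟩
      obtain ⟨x', y', h', rfl, rfl⟩ := hadj x y h
      exact ⟨x', y', h', rfl, rfl⟩

/-- The vertex map is `g` followed by the inverse of `f` on the common image. It preserves edges
because every edge of the image comes from an edge of `T` under the injective `f`. -/
lemma exists_comp_of_toSubgraph_eq {k n : ℕ} {T : SimpleGraph (Fin k)} {G : SimpleGraph (Fin n)}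
    (f g : T.Copy G) (h : g.toSubgraph = f.toSubgraph) : ∃ e : T.Copy T, f.comp e = g := by
  have hv : ∀ a, ∃ b, f b = g a := by
    intro a
    have h1 : g a ∈ g.toSubgraph.verts := ⟨a, trivial, rfl⟩
    rw [h] at h1
    obtain ⟨b, -, hb⟩ := h1
    exact ⟨b, hb⟩
  choose e he using hv
  refine ⟨⟨⟨e, fun {a b} hab => ?_⟩, fun a b hab => ?_⟩, ?_⟩
  · have h1 : g.toSubgraph.Adj (g a) (g b) := ⟨a, b, hab, rfl, rfl⟩
    rw [h] at h1
    obtain ⟨x, y, hxy, hx, hy⟩ := h1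
    have h2 : x = e a := f.injective (hx.trans (he a).symm)
    have h3 : y = e b := f.injective (hy.trans (he b).symm)
    exact h2 ▸ h3 ▸ hxy
  · refine g.injective ((he a).symm.trans (Eq.trans ?_ (he b)))
    exact congrArg f hab
  · ext a
    exact congrArg Fin.val (he a)

/-- Every subgraph isomorphic to `T` is the image of as many copies as `T` has automorphisms. -/
theorem labelledCopyCount_eq_copyCount_mul {k n : ℕ} (T : SimpleGraph (Fin k))
    (G : SimpleGraph (Fin n)) :
    G.labelledCopyCount T = G.copyCount T * T.labelledCopyCount T := by
  classical
  rw [SimpleGraph.copyCount_eq_card_image_copyToSubgraph, labelledCopyCount_eq_nat_card,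
    Nat.card_eq_fintype_card, ← card_univ,
    card_eq_sum_card_image (fun f : T.Copy G => f.toSubgraph) univ]
  refine sum_const_nat fun H hH => ?_
  obtain ⟨f, -, rfl⟩ := mem_image.1 hH
  rw [labelledCopyCount_eq_nat_card, Nat.card_eq_fintype_card, ← card_univ]
  symm
  -- Composition with one fixed copy identifies the self-copies of `T` with all copies having the
  -- same image.
  refine card_bij (fun g _ => f.comp g) ?_ ?_ ?_
  · intro g _
    simp only [mem_filter, mem_univ, true_and]
    exact toSubgraph_comp f g
  · intro g _ g' _ h
    ext a : 1
    exact f.injective (congrArg (fun q : T.Copy G => q a) h)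
  · intro g hg
    simp only [mem_filter, mem_univ, true_and] at hg
    obtain ⟨e, he⟩ := exists_comp_of_toSubgraph_eq f g hg
    exact ⟨e, mem_univ _, he⟩

/-! ### Elimination of leaves -/

namespace LeafElimination

variable {k n : ℕ} (T : SimpleGraph (Fin k)) (G : SimpleGraph (Fin n))

open Classical in
/-- Weighted sum over the maps that are homomorphisms on the set `R` of remaining nodes. -/
noncomputable def restrictedSum (R : Finset (Fin k)) (g : Fin k → Fin n → ℕ) : ℕ :=
  -- The maps stay defined on all nodes, so the index type never changes; each node outside `R` is
  -- free and contributes a factor `n`.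
  ∑ φ : Fin k → Fin n, if ∀ u ∈ R, ∀ v ∈ R, T.Adj u v → G.Adj (φ u) (φ v) then
    ∏ u ∈ R, g u (φ u) else 0

/-- The node `u` is a leaf among the remaining nodes `R`, with neighbour `p`. -/
structure IsLeaf (R : Finset (Fin k)) (u p : Fin k) : Prop where
  mem : u ∈ R
  mem' : p ∈ R
  adj : T.Adj u p
  unique : ∀ w ∈ R, T.Adj u w → w = p

open Classical in
/-- Elimination of a leaf `u` with neighbour `p`. -/
noncomputable def eliminate (g : Fin k → Fin n → ℕ) (u p : Fin k) : Fin k → Fin n → ℕ :=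
  Function.update g p fun v => g p v * ∑ v', if G.Adj v v' then g u v' else 0

/-- Exchanging `v` with the value of `φ` at `u` is an involution on pairs `(φ, v)`. -/
lemma sum_sum_update (u : Fin k) (F : (Fin k → Fin n) → ℕ) :
    ∑ φ : Fin k → Fin n, ∑ v, F (Function.update φ u v) = n * ∑ φ, F φ := by
  rw [← Fintype.sum_prod_type', mul_comm, sum_mul]
  have : ∀ φ : Fin k → Fin n, F φ * n = ∑ _v : Fin n, F φ := fun φ => by simp [mul_comm]
  rw [sum_congr rfl fun φ _ => this φ, ← Fintype.sum_prod_type' (fun φ _ => F φ)]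
  let e : (Fin k → Fin n) × Fin n → (Fin k → Fin n) × Fin n :=
    fun x => (Function.update x.1 u x.2, x.1 u)
  have he : Function.Involutive e := fun x => by simp [e]
  exact Fintype.sum_equiv he.toPerm _ _ fun x => rfl

variable {T}

/-- Fix `φ` away from `u` and sum over its value at `u`. The only constraint on that value is
adjacency to `φ p`, so the sum is a factor depending on `φ p` alone. -/
lemma restrictedSum_eliminate {R : Finset (Fin k)} {u p : Fin k} (h : IsLeaf T R u p)
    (g : Fin k → Fin n → ℕ) :
    restrictedSum T G (R.erase u) (eliminate G g u p) = n * restrictedSum T G R g := by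
  classical
  have hpu : p ≠ u := h.adj.ne'
  rw [restrictedSum, restrictedSum, ← sum_sum_update u]
  refine sum_congr rfl fun φ _ => ?_
  have h1 : ∀ v, (∀ a ∈ R, ∀ b ∈ R, T.Adj a b →
      G.Adj (Function.update φ u v a) (Function.update φ u v b)) ↔
      (∀ a ∈ R.erase u, ∀ b ∈ R.erase u, T.Adj a b → G.Adj (φ a) (φ b)) ∧ G.Adj (φ p) v := by
    intro v
    constructor
    · intro H
      refine ⟨fun a ha b hb hab => ?_, ?_⟩
      · have := H a (mem_of_mem_erase ha) b (mem_of_mem_erase hb) hab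
        rwa [Function.update_of_ne (ne_of_mem_erase ha),
          Function.update_of_ne (ne_of_mem_erase hb)] at this
      · have := H p h.mem' u h.mem h.adj.symm
        rwa [Function.update_self, Function.update_of_ne hpu] at this
    · rintro ⟨H, hv⟩ a ha b hb hab
      by_cases hau : a = u
      · subst hau
        obtain rfl := h.unique b hb hab
        rw [Function.update_self, Function.update_of_ne hpu]
        exact hv.symm
      · by_cases hbu : b = u
        · subst hbu
          obtain rfl := h.unique a ha hab.symm
          rw [Function.update_self, Function.update_of_ne hpu]
          exact hv
        · rw [Function.update_of_ne hau, Function.update_of_ne hbu]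
          exact H a (mem_erase.2 ⟨hau, ha⟩) b (mem_erase.2 ⟨hbu, hb⟩) hab
  have h2 : ∀ v, ∏ a ∈ R, g a (Function.update φ u v a) =
      g u v * ∏ a ∈ R.erase u, g a (φ a) := by
    intro v
    rw [← mul_prod_erase R _ h.mem, Function.update_self]
    congr 1
    exact prod_congr rfl fun a ha => by rw [Function.update_of_ne (ne_of_mem_erase ha)]
  have hp : p ∈ R.erase u := mem_erase.2 ⟨hpu, h.mem'⟩
  have h3 : ∏ a ∈ R.erase u, eliminate G g u p a (φ a) =
      (∑ v', if G.Adj (φ p) v' then g u v' else 0) * ∏ a ∈ R.erase u, g a (φ a) := by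
    rw [← mul_prod_erase _ _ hp, ← mul_prod_erase (R.erase u) (fun a => g a (φ a)) hp, eliminate,
      Function.update_self]
    rw [prod_congr rfl fun a ha => by rw [Function.update_of_ne (ne_of_mem_erase ha)]]
    ring
  simp only [h1, h2, h3, ite_and, sum_mul, ite_mul, zero_mul]
  split_ifs <;> simp

lemma exists_isLeaf {R : Finset (Fin k)} (hT : (T.induce (R : Set (Fin k))).IsTree)
    (hR : 1 < #R) : ∃ u p, IsLeaf T R u p := by
  classical
  have : Nontrivial (R : Set (Fin k)) := by
    obtain ⟨a, ha, b, hb, hab⟩ := one_lt_card.1 hR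
    exact ⟨⟨a, ha⟩, ⟨b, hb⟩, fun h => hab (congrArg Subtype.val h)⟩
  obtain ⟨u, hu⟩ := hT.exists_vert_degree_one_of_nontrivial
  obtain ⟨p, hp, hp'⟩ := SimpleGraph.degree_eq_one_iff_existsUnique_adj.1 hu
  exact ⟨u, p, u.2, p.2, hp, fun w hw h => congrArg Subtype.val (hp' ⟨w, hw⟩ h)⟩

lemma IsLeaf.isTree_erase {R : Finset (Fin k)} {u p : Fin k} (h : IsLeaf T R u p)
    (hT : (T.induce (R : Set (Fin k))).IsTree) :
    (T.induce (R.erase u : Set (Fin k))).IsTree := by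
  refine ⟨?_, ?_⟩
  · have hpre := hT.connected.preconnected.induce_of_degree_eq_one
      (s := {x : (R : Set (Fin k)) | x.1 ≠ u}) (by
        rintro ⟨v, hv⟩ hvs a ha b hb
        obtain rfl : v = u := by simpa using hvs
        exact Subtype.ext ((h.unique _ a.2 ha).trans (h.unique _ b.2 hb).symm))
    have hpre' : (T.induce (R.erase u : Set (Fin k))).Preconnected := by
      refine hpre.map ⟨fun x => ⟨x.1.1, ?_⟩, ?_⟩ ?_
      · exact mem_coe.2 (mem_erase.2 ⟨x.2, x.1.2⟩)
      · intro a b hab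
        exact hab
      · rintro ⟨x, hx⟩
        have hx' := mem_erase.1 (mem_coe.1 hx)
        exact ⟨⟨⟨x, hx'.2⟩, hx'.1⟩, rfl⟩
    have : Nonempty (R.erase u : Set (Fin k)) := ⟨⟨p, by simp [h.adj.ne', h.mem']⟩⟩
    exact ⟨hpre'⟩
  · exact hT.isAcyclic.comap ⟨fun x => ⟨x.1, mem_of_mem_erase (mem_coe.1 x.2)⟩, fun h => h⟩
      fun a b hab => Subtype.ext (congrArg (fun y : (R : Set (Fin k)) => y.1) hab)

variable (T)

/-- Invariant of the elimination. -/
structure Inv (w : ℕ → ℕ) (B : ℕ) (R : Finset (Fin k)) (g : Fin k → Fin n → ℕ) : Prop where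
  isTree : (T.induce (R : Set (Fin k))).IsTree
  sum_eq : restrictedSum T G R g = n ^ (k - #R) * homSum T G w
  -- For a remaining node, `c u` is the number of original nodes merged into `u`, itself included.
  -- Bounding `n * g` rather than `g` absorbs the sum over the `n` values of an eliminated leaf, so
  -- entries never exceed `B ^ k`.
  bound : ∃ c : Fin k → ℕ, (∀ u, c u ≤ k) ∧ ∑ u ∈ R, c u = k ∧ ∀ u v, n * g u v ≤ B ^ c u

variable {T G}

lemma Inv.init (hT : T.IsTree) {w : ℕ → ℕ} {B : ℕ} (hw : ∀ v < n, n * w v ≤ B) :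
    Inv T G w B univ fun _ v => w v := by
  refine ⟨?_, ?_, fun _ => 1, ?_, by simp, fun u v => by simpa using hw v v.2⟩
  · rw [coe_univ]
    exact (SimpleGraph.induceUnivIso T).isTree_iff.2 hT
  · classical
    simp only [restrictedSum, homSum, card_univ, Fintype.card_fin, Nat.sub_self, pow_zero, one_mul,
      mem_univ, true_imp_iff]
  · intro u
    exact Nat.one_le_of_lt u.2

lemma Inv.eliminate {w : ℕ → ℕ} {B : ℕ} {R : Finset (Fin k)} {g : Fin k → Fin n → ℕ}
    (h : Inv T G w B R g) {u p : Fin k} (hl : IsLeaf T R u p) :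
    Inv T G w B (R.erase u) (eliminate G g u p) := by
  classical
  refine ⟨hl.isTree_erase h.isTree, ?_, ?_⟩
  · rw [restrictedSum_eliminate G hl, h.sum_eq, card_erase_of_mem hl.mem, ← mul_assoc, ← pow_succ']
    have h1 : 0 < #R := card_pos.2 ⟨u, hl.mem⟩
    have h2 : #R ≤ k := (card_le_univ R).trans (by simp)
    congr 2
    omega
  · obtain ⟨c, hc, hs, hb⟩ := h.bound
    have hp : p ∈ R.erase u := mem_erase.2 ⟨hl.adj.ne', hl.mem'⟩
    have hs' : ∑ x ∈ R.erase u, Function.update c p (c p + c u) x = k := by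
      rw [← add_sum_erase _ _ hp, Function.update_self,
        sum_congr rfl fun x hx => Function.update_of_ne (ne_of_mem_erase hx) _ _]
      rw [← add_sum_erase R _ hl.mem, ← add_sum_erase _ _ hp] at hs
      omega
    refine ⟨Function.update c p (c p + c u), fun x => ?_, hs', fun x v => ?_⟩
    · by_cases hx : x = p
      · subst hx
        exact (single_le_sum (f := Function.update c x (c x + c u)) (fun _ _ => Nat.zero_le _)
          hp).trans_eq hs'
      · rw [Function.update_of_ne hx]
        exact hc x
    · by_cases hx : x = p
      · subst hx
        rw [LeafElimination.eliminate, Function.update_self, Function.update_self, pow_add,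
          ← mul_assoc]
        refine Nat.mul_le_mul (hb x v) ?_
        rcases Nat.eq_zero_or_pos n with rfl | hn
        · exact v.elim0
        · refine Nat.le_of_mul_le_mul_left (?_ : n * _ ≤ n * _) hn
          rw [mul_sum]
          calc _ ≤ ∑ _v' : Fin n, B ^ c u := sum_le_sum fun v' _ => by
                split_ifs
                · exact hb u v'
                · simp
            _ = n * B ^ c u := by simp
      · rw [LeafElimination.eliminate, Function.update_of_ne hx, Function.update_of_ne hx]
        exact hb x v

lemma Inv.mul_le {w : ℕ → ℕ} {B : ℕ} (hB : 0 < B) {R : Finset (Fin k)} {g : Fin k → Fin n → ℕ}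
    (h : Inv T G w B R g) (u : Fin k) (v : Fin n) : n * g u v ≤ B ^ k := by
  obtain ⟨c, hc, -, hb⟩ := h.bound
  exact (hb u v).trans (Nat.pow_le_pow_right hB (hc u))

lemma Inv.le {w : ℕ → ℕ} {B : ℕ} (hB : 0 < B) {R : Finset (Fin k)} {g : Fin k → Fin n → ℕ}
    (h : Inv T G w B R g) (u : Fin k) (v : Fin n) : g u v ≤ B ^ k :=
  (Nat.le_mul_of_pos_left _ (by have := v.2; omega)).trans (h.mul_le hB u v)

/-- With one node left there is no adjacency condition, and the other `k - 1` free coordinates give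
exactly the power of `n` in the invariant, which cancels. -/
lemma Inv.sum_of_card_le_one {w : ℕ → ℕ} {B : ℕ} {R : Finset (Fin k)} {g : Fin k → Fin n → ℕ}
    (h : Inv T G w B R g) (hn : 0 < n) (hR : #R ≤ 1) :
    ∑ u ∈ R, ∑ v, g u v = homSum T G w := by
  classical
  obtain ⟨⟨r, hr⟩⟩ := h.isTree.connected.nonempty
  obtain rfl : R = {r} := 
    Subset.antisymm (fun x hx => mem_singleton.2 (card_le_one.1 hR x hx r hr))
      (singleton_subset_iff.2 hr)
  have h1 := h.sum_eq
  rw [restrictedSum] at h1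
  simp only [mem_singleton, forall_eq, SimpleGraph.irrefl, false_imp_iff, if_true, prod_singleton,
    card_singleton] at h1
  have h2 := sum_sum_update r fun φ : Fin k → Fin n => g r (φ r)
  simp only [Function.update_self, sum_const, card_univ, Fintype.card_pi, Fintype.card_fin,
    prod_const, smul_eq_mul] at h2
  rw [h1, ← mul_assoc, ← pow_succ', Nat.sub_add_cancel (by have := r.2; omega)] at h2
  rw [sum_singleton]
  exact Nat.eq_of_mul_eq_mul_left (by positivity) h2

end LeafElimination

namespace RAM

/-! ### Reasoning about programs -/

@[simp] lemma State.reg_setReg (s : State) (x v y : ℕ) :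
    (s.setReg x v).reg y = if y = x then v else s.reg y := by
  simp [State.setReg, Function.update_apply]

@[simp] lemma State.arr_setReg (s : State) (x v : ℕ) : (s.setReg x v).arr = s.arr := rfl

@[simp] lemma State.reg_setArr (s : State) (a i v : ℕ) : (s.setArr a i v).reg = s.reg := rfl

@[simp] lemma State.arr_setArr (s : State) (a i v b j : ℕ) :
    (s.setArr a i v).arr b j = if b = a ∧ j = i then v else s.arr b j := by
  by_cases h : b = a
  · subst h
    simp [State.setArr, Function.update_apply]
  · simp [State.setArr, h]

/-! ### Bit lengths and costs of expressions -/

/-- All cells hold numbers of at most `L` bits. -/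
def Bounded (L : ℕ) (s : State) : Prop :=
  (∀ x, s.reg x < 2 ^ L) ∧ ∀ a i, s.arr a i < 2 ^ L

lemma Bounded.setReg {L : ℕ} {s : State} (h : Bounded L s) {x v : ℕ} (hv : v < 2 ^ L) :
    Bounded L (s.setReg x v) := by
  refine ⟨fun y => ?_, fun a i => h.2 a i⟩
  rw [State.reg_setReg]
  split_ifs
  · exact hv
  · exact h.1 y

lemma Bounded.setArr {L : ℕ} {s : State} (h : Bounded L s) {a i v : ℕ} (hv : v < 2 ^ L) :
    Bounded L (s.setArr a i v) := by
  refine ⟨fun y => h.1 y, fun b j => ?_⟩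
  rw [State.arr_setArr]
  split_ifs
  · exact hv
  · exact h.2 b j

/-- Size factor of an expression: its value has at most `e.scale * L` bits if all cells have at
most `L` bits. -/
def Expr.scale : Expr → ℕ
  | .lit c => c + 1
  | .reg _ => 1
  | .get _ _ => 1
  | .op _ e₁ e₂ => e₁.scale + e₂.scale

/-- Cost factor of an expression. -/
def Expr.weight : Expr → ℕ
  | .lit c => c + 1
  | .reg _ => 2
  | .get _ i => i.weight + i.scale + 3
  | .op _ e₁ e₂ => e₁.weight + e₂.weight + e₁.scale + e₂.scale + 2

lemma Expr.scale_pos (e : Expr) : 0 < e.scale := by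
  induction e with
  | op o e f he hf => simp only [Expr.scale]; omega
  | _ => simp [Expr.scale]

lemma Expr.val_lt {L : ℕ} (hL : 0 < L) {s : State} (h : Bounded L s) (e : Expr) :
    e.val s < 2 ^ (e.scale * L) := by
  induction e with
  | lit c =>
    calc c < 2 ^ c := Nat.lt_two_pow_self
      _ ≤ _ := Nat.pow_le_pow_right (by norm_num) (by simp only [Expr.scale]; nlinarith)
  | reg x => simpa [Expr.scale, Expr.val] using h.1 x
  | get a i => simpa [Expr.scale, Expr.val] using h.2 a _
  | op o e f he hf =>
    simp only [Expr.val, Expr.scale, add_mul, pow_add]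
    have h1 : 2 ≤ 2 ^ (e.scale * L) := Nat.le_self_pow (Nat.mul_pos e.scale_pos hL).ne' 2
    have h2 : 2 ≤ 2 ^ (f.scale * L) := Nat.le_self_pow (Nat.mul_pos f.scale_pos hL).ne' 2
    cases o with
    | add => simp only [Op.apply]; nlinarith
    | sub => simp only [Op.apply]; nlinarith [Nat.sub_le (e.val s) (f.val s)]
    | mul => exact Nat.mul_lt_mul'' he hf
    | div => simp only [Op.apply]; nlinarith [Nat.div_le_self (e.val s) (f.val s)]

lemma len_le {v m : ℕ} (h : v < 2 ^ m) : len v ≤ m + 1 :=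
  Nat.succ_le_succ (Nat.size_le.2 h)

lemma Expr.cost_le {L : ℕ} (hL : 0 < L) {s : State} (h : Bounded L s) (e : Expr) :
    e.cost s ≤ e.weight * L := by
  induction e with
  | lit c =>
    have := len_le (v := c) Nat.lt_two_pow_self
    simp only [Expr.cost, Expr.weight]
    nlinarith
  | reg x =>
    have := len_le (h.1 x)
    simp only [Expr.cost, Expr.weight]
    omega
  | get a i hi =>
    have h1 := len_le (h.2 a (i.val s))
    have h2 := len_le (i.val_lt hL h)
    simp only [Expr.cost, Expr.weight]
    linarith
  | op o e f he hf =>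
    have h1 := len_le (e.val_lt hL h)
    have h2 := len_le (f.val_lt hL h)
    simp only [Expr.cost, Expr.weight]
    linarith

/-- Cost factor for the evaluation of an expression and the use of its value. -/
def Expr.charge (e : Expr) : ℕ := e.weight + e.scale + 1

lemma Expr.cost_add_len_le {L : ℕ} (hL : 0 < L) {s : State} (h : Bounded L s) (e : Expr) :
    e.cost s + len (e.val s) ≤ e.charge * L := by
  have h1 := e.cost_le hL h
  have h2 := len_le (e.val_lt hL h)
  simp only [Expr.charge]
  linarith

/-- The largest charge of a single step of a program. -/
def Prog.charge : Prog → ℕ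
  | .skip => 1
  | .assign _ e => e.charge
  | .store _ i e => i.charge + e.charge
  | .seq p q => max p.charge q.charge
  | .cond e p q => max e.charge (max p.charge q.charge)
  | .loop e p => max e.charge p.charge

/-! ### Frame conditions -/

/-- The registers that a program may change. -/
def Prog.regs : Prog → List ℕ
  | .skip => []
  | .assign x _ => [x]
  | .store _ _ _ => []
  | .seq p q => p.regs ++ q.regs
  | .cond _ p q => p.regs ++ q.regs
  | .loop _ p => p.regs

/-- The arrays that a program may change. -/
def Prog.arrs : Prog → List ℕ
  | .skip => []
  | .assign _ _ => []
  | .store a _ _ => [a]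
  | .seq p q => p.arrs ++ q.arrs
  | .cond _ p q => p.arrs ++ q.arrs
  | .loop _ p => p.arrs

/-- The states agree outside the given registers and arrays. -/
structure Agree (l m : List ℕ) (s s' : State) : Prop where
  reg : ∀ x, x ∉ l → s'.reg x = s.reg x
  arr : ∀ a, a ∉ m → s'.arr a = s.arr a

lemma Agree.refl (l m : List ℕ) (s : State) : Agree l m s s := ⟨fun _ _ => rfl, fun _ _ => rfl⟩

lemma Agree.trans {l m : List ℕ} {s s' s'' : State} (h : Agree l m s s') (h' : Agree l m s' s'') :
    Agree l m s s'' :=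
  ⟨fun x hx => (h'.reg x hx).trans (h.reg x hx), fun x hx => (h'.arr x hx).trans (h.arr x hx)⟩

lemma Agree.mono {l m l' m' : List ℕ} {s s' : State} (h : Agree l m s s') (hl : l ⊆ l')
    (hm : m ⊆ m') : Agree l' m' s s' :=
  ⟨fun x hx => h.reg x fun h' => hx (hl h'), fun x hx => h.arr x fun h' => hx (hm h')⟩

/-- The frame rule. The lists are computed from the program text, so for concrete programs `decide`
shows that a cell is untouched. -/
lemma Exec.agree {p : Prog} {s s' : State} {t : ℕ} (h : Exec p s t s') :
    Agree p.regs p.arrs s s' := by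
  induction h with
  | skip s => exact .refl _ _ _
  | assign s x e =>
    refine ⟨fun y hy => ?_, fun _ _ => rfl⟩
    simp only [Prog.regs, List.mem_singleton] at hy
    simp [hy]
  | store s a i e =>
    refine ⟨fun _ _ => rfl, fun b hb => ?_⟩
    simp only [Prog.arrs, List.mem_singleton] at hb
    funext j
    simp [hb]
  | seq _ _ h1 h2 =>
    exact (h1.mono (List.subset_append_left _ _) (List.subset_append_left _ _)).trans
      (h2.mono (List.subset_append_right _ _) (List.subset_append_right _ _))
  | cond_true _ _ h => exact h.mono (List.subset_append_left _ _) (List.subset_append_left _ _)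
  | cond_false _ _ h => exact h.mono (List.subset_append_right _ _) (List.subset_append_right _ _)
  | loop_done _ => exact .refl _ _ _
  | loop_step _ _ _ h1 h2 => exact h1.trans h2

/-! ### Rules for termination, time and postconditions -/

/-- Started in the state `s` with cells of at most `L` bits, the program `p` halts after at most
`N` steps, keeping all cells within `L` bits, in a state with property `Q`. -/
def Runs (L : ℕ) (p : Prog) (s : State) (N : ℕ) (Q : State → Prop) : Prop :=
  -- `N` counts steps, while `p.charge * L` bounds the cost of one step; `p.charge` depends on the
  -- program text only.
  Bounded L s → ∃ t s', Exec p s t s' ∧ t ≤ N * (p.charge * L) ∧ Bounded L s' ∧ Q s'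

namespace Runs

variable {L : ℕ} {s : State} {N N₁ N₂ : ℕ} {Q Q₁ : State → Prop} {p q : Prog} {e : Expr}

lemma mono (h : Runs L p s N₁ Q₁) (hN : N₁ ≤ N) (hQ : ∀ s', Agree p.regs p.arrs s s' → Q₁ s' → Q s') :
    Runs L p s N Q := fun hs => by
  obtain ⟨t, s', h1, h2, h3, h4⟩ := h hs
  exact ⟨t, s', h1, h2.trans (Nat.mul_le_mul_right _ hN), h3, hQ s' h1.agree h4⟩

/-- Needed where a program copies a cell whose size is known only from the boundedness of the
memory. -/
lemma of_bounded (h : Bounded L s → Runs L p s N Q) : Runs L p s N Q := fun hs => h hs hs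

lemma skip (hL : 0 < L) (h : Q s) : Runs L .skip s 1 Q := fun hs =>
  ⟨1, s, .skip s, by simp [Prog.charge]; omega, hs, h⟩

lemma assign (hL : 0 < L) {x : ℕ} (hv : e.val s < 2 ^ L) (h : Q (s.setReg x (e.val s))) :
    Runs L (.assign x e) s 1 Q := fun hs =>
  ⟨_, _, .assign s x e, by simpa [Prog.charge] using e.cost_add_len_le hL hs, hs.setReg hv, h⟩

lemma store (hL : 0 < L) {a : ℕ} {i : Expr} (hv : e.val s < 2 ^ L)
    (h : Q (s.setArr a (i.val s) (e.val s))) : Runs L (.store a i e) s 1 Q := fun hs =>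
  ⟨_, _, .store s a i e, by
    have h1 := e.cost_add_len_le hL hs
    have h2 := i.cost_add_len_le hL hs
    simp only [Prog.charge]
    linarith, hs.setArr hv, h⟩

lemma seq (hp : Runs L p s N₁ Q₁)
    (hq : ∀ s', Agree p.regs p.arrs s s' → Q₁ s' → Runs L q s' N₂ Q) :
    Runs L (.seq p q) s (N₁ + N₂) Q := fun hs => by
  obtain ⟨t₁, s₁, h1, h2, h3, h4⟩ := hp hs
  obtain ⟨t₂, s₂, h5, h6, h7, h8⟩ := hq s₁ h1.agree h4 h3
  refine ⟨_, _, .seq h1 h5, ?_, h7, h8⟩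
  rw [add_mul]
  refine Nat.add_le_add (h2.trans ?_) (h6.trans ?_)
  · exact Nat.mul_le_mul_left _ (Nat.mul_le_mul_right _ (le_max_left _ _))
  · exact Nat.mul_le_mul_left _ (Nat.mul_le_mul_right _ (le_max_right _ _))

lemma assign_seq (hL : 0 < L) {x : ℕ} (hv : e.val s < 2 ^ L)
    (h : Runs L q (s.setReg x (e.val s)) N Q) : Runs L (.seq (.assign x e) q) s (N + 1) Q := by
  rw [add_comm]
  exact seq (Q₁ := fun s' => s' = s.setReg x (e.val s)) (assign hL hv rfl)
    fun s' _ hs' => hs' ▸ h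

lemma store_seq (hL : 0 < L) {a : ℕ} {i : Expr} (hv : e.val s < 2 ^ L)
    (h : Runs L q (s.setArr a (i.val s) (e.val s)) N Q) :
    Runs L (.seq (.store a i e) q) s (N + 1) Q := by
  rw [add_comm]
  exact seq (Q₁ := fun s' => s' = s.setArr a (i.val s) (e.val s)) (store hL hv rfl)
    fun s' _ hs' => hs' ▸ h

lemma cond (hL : 0 < L) (hp : e.val s ≠ 0 → Runs L p s N Q) (hq : e.val s = 0 → Runs L q s N Q) :
    Runs L (.cond e p q) s (N + 1) Q := fun hs => by
  have hc := e.cost_add_len_le hL hs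
  have h1 : e.charge * L ≤ (Prog.cond e p q).charge * L :=
    Nat.mul_le_mul_right _ (le_max_left _ _)
  by_cases he : e.val s = 0
  · obtain ⟨t, s', h2, h3, h4, h5⟩ := hq he hs
    refine ⟨_, _, .cond_false he h2, ?_, h4, h5⟩
    have h6 : N * (q.charge * L) ≤ N * ((Prog.cond e p q).charge * L) :=
      Nat.mul_le_mul_left _ (Nat.mul_le_mul_right _
        ((le_max_right _ _).trans (le_max_right _ _)))
    rw [add_mul, one_mul]
    omega
  · obtain ⟨t, s', h2, h3, h4, h5⟩ := hp he hs
    refine ⟨_, _, .cond_true he h2, ?_, h4, h5⟩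
    have h6 : N * (p.charge * L) ≤ N * ((Prog.cond e p q).charge * L) :=
      Nat.mul_le_mul_left _ (Nat.mul_le_mul_right _
        ((le_max_left _ _).trans (le_max_right _ _)))
    rw [add_mul, one_mul]
    omega

/-- A while loop with an invariant `I` and a potential `Φ` that pays for the steps. -/
lemma loop (hL : 0 < L) (I : State → Prop) (Φ : State → ℕ) (h0 : I s)
    (hbody : ∀ s', Agree p.regs p.arrs s s' → I s' → e.val s' ≠ 0 →
      ∃ N, Runs L p s' N fun s'' => I s'' ∧ Φ s'' + N + 1 ≤ Φ s') :
    Runs L (.loop e p) s (Φ s + 1) fun s' => I s' ∧ e.val s' = 0 := by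
  have key : ∀ m s', Φ s' = m → Agree p.regs p.arrs s s' → I s' →
      Runs L (.loop e p) s' (m + 1) fun s' => I s' ∧ e.val s' = 0 := by
    intro m
    induction m using Nat.strong_induction_on with
    | _ m ih =>
      intro s' hm hagree hI hs
      have hc := e.cost_add_len_le hL hs
      have h1 : e.charge * L ≤ (Prog.loop e p).charge * L :=
        Nat.mul_le_mul_right _ (le_max_left _ _)
      by_cases he : e.val s' = 0
      · refine ⟨_, _, .loop_done he, ?_, hs, hI, he⟩
        rw [add_mul, one_mul]
        omega
      · obtain ⟨N, hN⟩ := hbody s' hagree hI he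
        obtain ⟨t, s₁, h2, h3, h4, h5, h6⟩ := hN hs
        obtain ⟨t₂, s₂, h7, h8, h9, h10⟩ := ih (Φ s₁) (by omega) s₁ rfl
          (hagree.trans h2.agree) h5 h4
        refine ⟨_, _, .loop_step he h2 h7, ?_, h9, h10⟩
        have h11 : N * (p.charge * L) ≤ N * ((Prog.loop e p).charge * L) :=
          Nat.mul_le_mul_left _ (Nat.mul_le_mul_right _ (le_max_right _ _))
        have h12 : (Φ s₁ + 1) + N + 1 ≤ m + 1 := by omega
        have h13 := Nat.mul_le_mul_right ((Prog.loop e p).charge * L) h12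
        simp only [add_mul, one_mul] at h13 h8 ⊢
        omega
  exact key _ s rfl (.refl _ _ _) h0

end Runs

/-- The loop `for i = 0, …, e - 1 do p`. -/
def Prog.forTo (i : ℕ) (e : Expr) (p : Prog) : Prog :=
  .seq (.assign i (.lit 0)) (.loop (.op .sub e (.reg i))
    (.seq p (.assign i (.op .add (.reg i) (.lit 1)))))

/-- Each pass pays `N` for the body and two for increment and test; the final `2` pays for the
initialization and the last test. The limit `e` is reevaluated at every test, hence `he`. -/
lemma Runs.forTo {L : ℕ} (hL : 0 < L) {s : State} {i : ℕ} {e : Expr} {p : Prog} {m N : ℕ}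
    (I : ℕ → State → Prop) (hm : m < 2 ^ L)
    (he : ∀ s', Agree (i :: p.regs) p.arrs s s' → e.val s' = m)
    (h0 : I 0 (s.setReg i 0))
    (hbody : ∀ j < m, ∀ s', Agree (i :: p.regs) p.arrs s s' → s'.reg i = j → I j s' →
      Runs L p s' N fun s'' => s''.reg i = j ∧ I (j + 1) (s''.setReg i (j + 1))) :
    Runs L (.forTo i e p) s (m * (N + 2) + 2) fun s' => I m s' ∧ s'.reg i = m := by
  have hagree : ∀ s', Agree (p.regs ++ [i]) (p.arrs ++ []) (s.setReg i 0) s' →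
      Agree (i :: p.regs) p.arrs s s' := by
    intro s' h
    refine Agree.trans (s' := s.setReg i 0) ⟨fun x hx => ?_, fun _ _ => rfl⟩
      (h.mono (by simp) (by simp))
    have : x ≠ i := fun h => hx (by simp [h])
    simp [this]
  refine assign_seq hL (by simp [Expr.val]) ?_
  refine ((loop hL (fun s' => s'.reg i ≤ m ∧ I (s'.reg i) s') (fun s' => (m - s'.reg i) * (N + 2))
    ?_ ?_).mono ?_ ?_)
  · simpa [Expr.val] using h0
  · rintro s' h ⟨h1, h2⟩ h3
    have h4 := hagree s' h
    simp only [Expr.val, Op.apply, he s' h4] at h3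
    refine ⟨N + 1, (hbody (s'.reg i) (by omega) s' h4 rfl h2).seq (Q₁ := _) fun s'' _ h5 => ?_⟩
    have h6 : (Expr.op .add (.reg i) (.lit 1)).val s'' = s'.reg i + 1 := by
      simp [Expr.val, Op.apply, h5.1]
    refine assign hL (by rw [h6]; omega) ?_
    rw [h6]
    simp only [State.reg_setReg, if_true]
    refine ⟨⟨by omega, h5.2⟩, ?_⟩
    rw [show m - s'.reg i = m - (s'.reg i + 1) + 1 by omega, add_mul]
    omega
  · simp [Expr.val]
  · rintro s' h ⟨⟨h1, h2⟩, h3⟩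
    have h4 := he s' (hagree s' h)
    simp only [Expr.val, Op.apply, h4] at h3
    obtain h5 : s'.reg i = m := by omega
    exact ⟨h5 ▸ h2, h5⟩

instance : Add Expr := ⟨.op .add⟩
instance : Sub Expr := ⟨.op .sub⟩
instance : Mul Expr := ⟨.op .mul⟩
instance : Div Expr := ⟨.op .div⟩

@[simp] lemma Expr.val_add (s : State) (e f : Expr) : (e + f).val s = e.val s + f.val s := rfl
@[simp] lemma Expr.val_sub (s : State) (e f : Expr) : (e - f).val s = e.val s - f.val s := rfl
@[simp] lemma Expr.val_mul (s : State) (e f : Expr) : (e * f).val s = e.val s * f.val s := rfl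
@[simp] lemma Expr.val_div (s : State) (e f : Expr) : (e / f).val s = e.val s / f.val s := rfl
@[simp] lemma Expr.val_lit (s : State) (c : ℕ) : (Expr.lit c).val s = c := rfl
@[simp] lemma Expr.val_reg (s : State) (x : ℕ) : (Expr.reg x).val s = s.reg x := rfl
@[simp] lemma Expr.val_get (s : State) (a : ℕ) (i : Expr) :
    (Expr.get a i).val s = s.arr a (i.val s) := rfl

/-! ### The weighted number of homomorphisms

Registers: `0` is `k`, `1` is `n`, `14` is a node `u`, `20` its neighbour. Arrays: `0` and `1` hold
the adjacency matrices, `3` the vertex weights, `4` marks the remaining nodes, `5` is the table of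
the elimination. -/

open RAM.Expr in
/-- Elimination of the leaf in register `14` with the neighbour in register `20`. -/
def contract : Prog :=
  .seq (.store 4 (reg 14) (lit 0))
    (.forTo 15 (reg 1)
      (.seq (.assign 16 (lit 0))
      (.seq (.forTo 17 (reg 1) (.assign 16
        (reg 16 + get 1 (reg 15 * reg 1 + reg 17) * get 5 (reg 14 * reg 1 + reg 17))))
      (.store 5 (reg 20 * reg 1 + reg 15) (get 5 (reg 20 * reg 1 + reg 15) * reg 16)))))

open RAM.Expr in
/-- Elimination of the node in register `14` if it is a remaining leaf. -/
def contractIfLeaf : Prog :=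
  .cond (get 4 (reg 14))
    (.seq (.assign 19 (lit 0)) (.seq (.assign 20 (lit 0))
    (.seq (.forTo 21 (reg 0)
      (.seq (.assign 19 (reg 19 + get 4 (reg 21) * get 0 (reg 14 * reg 0 + reg 21)))
        -- The sum of the indices of the remaining neighbours, which is the neighbour itself if
        -- there is only one.
        (.assign 20 (reg 20 + get 4 (reg 21) * get 0 (reg 14 * reg 0 + reg 21) * reg 21))))
    -- With truncated subtraction this is nonzero exactly if the degree in register `19` is `1`.
    (.cond ((lit 1 - (reg 19 - lit 1)) * reg 19) contract .skip))))
    .skip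

open RAM.Expr in
/-- Initialization of the elimination. -/
def initElimination : Prog :=
  .forTo 14 (reg 0) (.seq (.store 4 (reg 14) (lit 1))
    (.forTo 15 (reg 1) (.store 5 (reg 14 * reg 1 + reg 15) (get 3 (reg 15)))))

open RAM.Expr in
/-- Elimination of leaves as long as possible. -/
def eliminateLeaves : Prog := .forTo 18 (reg 0) (.forTo 14 (reg 0) contractIfLeaf)

open RAM.Expr in
/-- Sum of the table over the remaining nodes, into register `22`. -/
def collect : Prog :=
  .seq (.assign 22 (lit 0)) (.forTo 14 (reg 0) (.forTo 15 (reg 1)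
    (.assign 22 (reg 22 + get 4 (reg 14) * get 5 (reg 14 * reg 1 + reg 15)))))

/-- The weighted number of homomorphisms, into register `22`. -/
def evalHomSum : Prog := .seq initElimination (.seq eliminateLeaves collect)

open Classical in
/-- The input is present in the memory. -/
structure HasInput {k n : ℕ} (T : SimpleGraph (Fin k)) (G : SimpleGraph (Fin n)) (s : State) :
    Prop where
  reg0 : s.reg 0 = k
  reg1 : s.reg 1 = n
  arr0 : ∀ u v : Fin k, s.arr 0 (u * k + v) = if T.Adj u v then 1 else 0
  arr1 : ∀ u v : Fin n, s.arr 1 (u * n + v) = if G.Adj u v then 1 else 0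

lemma HasInput.of_agree {k n : ℕ} {T : SimpleGraph (Fin k)} {G : SimpleGraph (Fin n)}
    {s s' : State} (h : HasInput T G s) {l m : List ℕ} (ha : Agree l m s s') (h0 : 0 ∉ l)
    (h1 : 1 ∉ l) (h2 : 0 ∉ m) (h3 : 1 ∉ m) : HasInput T G s' := by
  refine ⟨?_, ?_, ?_, ?_⟩
  · rw [ha.reg 0 h0, h.reg0]
  · rw [ha.reg 1 h1, h.reg1]
  · rw [ha.arr 0 h2]; exact h.arr0
  · rw [ha.arr 1 h3]; exact h.arr1

/-- Array `5` holds the table `g`. -/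
def HasTable {k n : ℕ} (g : Fin k → Fin n → ℕ) (s : State) : Prop :=
  ∀ (u : Fin k) (v : Fin n), s.arr 5 (u * n + v) = g u v

/-- Array `4` marks the elements of `R`. -/
def HasMarks {k : ℕ} (R : Finset (Fin k)) (s : State) : Prop :=
  ∀ u : Fin k, s.arr 4 u = if u ∈ R then 1 else 0

lemma mul_add_inj {n a b c d : ℕ} (hb : b < n) (hd : d < n) :
    a * n + b = c * n + d ↔ a = c ∧ b = d := by
  constructor
  · intro h
    have h1 : a = c := by
      have := congrArg (· / n) h
      simpa [Nat.add_div_of_dvd_right, Nat.add_comm, Nat.add_mul_div_right _ _ (by omega : 0 < n),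
        Nat.div_eq_of_lt hb, Nat.div_eq_of_lt hd] using this
    subst h1
    exact ⟨rfl, by omega⟩
  · rintro ⟨rfl, rfl⟩; rfl

variable {k n L : ℕ} {T : SimpleGraph (Fin k)} {G : SimpleGraph (Fin n)} {s : State}

/-- Row `p` can be overwritten in place: its new entries depend on the old entry in the same cell
and on row `u`, which differs from row `p` and stays unchanged. -/
lemma contract_spec (hL : 0 < L) (hn : n < 2 ^ L) (hs : HasInput T G s) {g : Fin k → Fin n → ℕ}
    (hg : HasTable g s) {R : Finset (Fin k)} (hR : HasMarks R s) {u p : Fin k} (hup : p ≠ u)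
    (h14 : s.reg 14 = u) (h20 : s.reg 20 = p) (hb : ∀ v, n * g u v < 2 ^ L)
    (hb' : ∀ v, LeafElimination.eliminate G g u p p v < 2 ^ L) :
    Runs L contract s (3 * n ^ 2 + 6 * n + 3) fun s' =>
      HasTable (LeafElimination.eliminate G g u p) s' ∧ HasMarks (R.erase u) s' := by
  classical
  set g' := LeafElimination.eliminate G g u p with hg'
  have hg'p : ∀ v, g' p v = g p v * ∑ v', if G.Adj v v' then g u v' else 0 := by
    intro v
    rw [hg', LeafElimination.eliminate, Function.update_self]
  have hg'o : ∀ a, a ≠ p → g' a = g a := by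
    intro a ha
    rw [hg', LeafElimination.eliminate, Function.update_of_ne ha]
  refine (Runs.store_seq (N := n * ((3 * n + 4) + 2) + 2) hL (by simp) ?_).mono
    (by nlinarith) (fun _ _ h => h)
  set s₀ := s.setArr 4 ((Expr.reg 14).val s) ((Expr.lit 0).val s) with hs₀
  have hs₀I : HasInput T G s₀ := ⟨hs.reg0, hs.reg1, hs.arr0, hs.arr1⟩
  have hs₀R : HasMarks (R.erase u) s₀ := by
    intro a
    simp only [hs₀, State.arr_setArr, Expr.val_reg, h14, Expr.val_lit, true_and, mem_erase, hR a,
      Fin.val_inj, ne_eq]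
    by_cases h : a = u <;> simp [h]
  have hs₀g : HasTable g s₀ := fun a v => by simp [hs₀, hg a v]
  refine (Runs.forTo hL (m := n) (N := 3 * n + 4) (fun j s' => ∀ (a : Fin k) (v : Fin n),
    s'.arr 5 (a * n + v) = if a = p ∧ v < j then g' a v else g a v) hn ?_ ?_ ?_).mono le_rfl ?_
  · intro s' h
    exact (hs₀I.of_agree h (by decide) (by decide) (by decide) (by decide)).reg1
  · intro a v
    simpa using hs₀g a v
  · intro j hj s₁ hagree h15 hI
    have hIn := hs₀I.of_agree hagree (by decide) (by decide) (by decide) (by decide)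
    have e14 : s₁.reg 14 = u := (hagree.reg 14 (by decide)).trans h14
    have e20 : s₁.reg 20 = p := (hagree.reg 20 (by decide)).trans h20
    have hrow : ∀ v : Fin n, s₁.arr 5 (u * n + v) = g u v := fun v => by
      rw [hI u v, if_neg (fun h => hup h.1.symm)]
    let f : ℕ → ℕ := fun v' => s₁.arr 1 (j * n + v') * s₁.arr 5 (u * n + v')
    have hf : ∀ v' : Fin n, f v' = if G.Adj ⟨j, hj⟩ v' then g u v' else 0 := by
      intro v'
      have := hIn.arr1 ⟨j, hj⟩ v'
      simp only [f, hrow, this]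
      simp
    have hfs : ∑ v' ∈ range n, f v' = ∑ v', if G.Adj ⟨j, hj⟩ v' then g u v' else 0 := by
      rw [Finset.sum_range]
      exact sum_congr rfl fun v' _ => hf v'
    have hfb : ∀ i ≤ n, ∑ v' ∈ range i, f v' < 2 ^ L := by
      intro i hi
      refine (sum_le_sum_of_subset (range_subset_range.2 hi)).trans_lt ?_
      rw [hfs]
      -- The hypothesis `hb` bounds `n` times each entry, so the sum is compared after
      -- multiplication by `n`.
      refine Nat.lt_of_mul_lt_mul_left (?_ : n * _ < n * _)
      rw [mul_sum]
      have : Nonempty (Fin n) := ⟨⟨j, hj⟩⟩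
      calc _ < ∑ _v' : Fin n, 2 ^ L := sum_lt_sum_of_nonempty univ_nonempty fun v' _ => by
            split_ifs
            · exact hb v'
            · simp
        _ = n * 2 ^ L := by simp
    refine (Runs.assign_seq (N := n * (1 + 2) + 2 + 1) hL (by simp) ?_).mono (by omega)
      (fun _ _ h => h)
    refine Runs.seq (Q₁ := fun s' => s'.reg 16 = ∑ v' ∈ range n, f v')
      ((Runs.forTo hL (m := n) (N := 1) (fun i s' => s'.reg 16 = ∑ v' ∈ range i, f v') hn
        ?_ ?_ ?_).mono le_rfl ?_) ?_
    · intro s' h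
      have := h.reg 1 (by decide)
      simp [this, hIn.reg1]
    · simp
    · intro i hi s₂ h2 h17 h16
      have e1 := h2.reg 1 (by decide)
      have e15 := h2.reg 15 (by decide)
      have e14' := h2.reg 14 (by decide)
      have a1 := h2.arr 1 (by decide)
      have a5 := h2.arr 5 (by decide)
      simp [hIn.reg1, h15, e14] at e1 e15 e14' a1 a5
      have hval : s₂.reg 16 + s₂.arr 1 (j * n + i) * s₂.arr 5 (u * n + i) =
          ∑ v' ∈ range (i + 1), f v' := by
        rw [sum_range_succ, h16, a1, a5]
      refine Runs.assign hL ?_ ?_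
      · simp only [Expr.val_add, Expr.val_reg, Expr.val_mul, Expr.val_get, e1, e15, e14', h17, hval]
        exact hfb _ hi
      · simp [e1, e15, e14', h17, hval]
    · rintro s' - ⟨h, -⟩
      exact h
    · intro s₃ h3 h16
      have e1 := h3.reg 1 (by decide)
      have e15 := h3.reg 15 (by decide)
      have e20' := h3.reg 20 (by decide)
      have a5 := h3.arr 5 (by decide)
      simp [hIn.reg1, h15, e20] at e1 e15 e20' a5
      have hval : s₃.arr 5 (p * n + j) * s₃.reg 16 = g' p ⟨j, hj⟩ := by
        have := hI p ⟨j, hj⟩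
        simp at this
        rw [a5, h16, hfs, hg'p, this]
      refine Runs.store hL ?_ ?_
      · simp only [Expr.val_add, Expr.val_reg, Expr.val_mul, Expr.val_get, e1, e15, e20', hval]
        exact hb' _
      · refine ⟨by simpa using e15, fun a v => ?_⟩
        simp only [State.arr_setReg, State.arr_setArr, true_and, Expr.val_add, Expr.val_mul,
          Expr.val_reg, Expr.val_get, e20', e1, e15, hval, mul_add_inj v.2 hj]
        by_cases hap : a = p
        · subst hap
          by_cases hv : (v : ℕ) = j
          · have : v = ⟨j, hj⟩ := Fin.ext hv
            simp [this]
          · rw [if_neg (by tauto), a5, hI a v]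
            exact if_congr (by constructor <;> rintro ⟨h1, h2⟩ <;> refine ⟨h1, ?_⟩ <;> omega)
              rfl rfl
        · rw [if_neg (fun h => hap (Fin.ext h.1)), a5, hI a v, if_neg (by tauto),
            if_neg (by tauto)]
  · rintro s' hagree ⟨h, -⟩
    refine ⟨fun a v => ?_, fun a => ?_⟩
    · rw [h a v]
      by_cases hap : a = p
      · simp [hap]
      · simp [hap, hg'o a hap]
    · rw [hagree.arr 4 (by decide)]
      exact hs₀R a

open LeafElimination

lemma contractIfLeaf_spec (hL : 0 < L) (hn : n < 2 ^ L) (hk : k ^ 2 < 2 ^ L) {w : ℕ → ℕ} {B : ℕ}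
    (hB : 0 < B) (hBL : B ^ k < 2 ^ L) (hs : HasInput T G s) {g : Fin k → Fin n → ℕ}
    (hg : HasTable g s) {R : Finset (Fin k)} (hR : HasMarks R s) (hI : Inv T G w B R g)
    {u : Fin k} (h14 : s.reg 14 = u) :
    Runs L contractIfLeaf s (3 * n ^ 2 + 6 * n + 4 * k + 9) fun s' => s'.reg 14 = u ∧
      ∃ R' g', HasTable g' s' ∧ HasMarks R' s' ∧ Inv T G w B R' g' ∧
        (#R' < #R ∨ R' = R ∧ ¬ ∃ p, IsLeaf T R u p) := by
  classical
  have hkk : k ≤ k ^ 2 := Nat.le_self_pow (by norm_num) k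
  refine (Runs.cond (N := 3 * n ^ 2 + 6 * n + 4 * k + 8) hL (fun h => ?_) (fun h => ?_)).mono
    (by omega) (fun _ _ h => h)
  swap
  · refine (Runs.skip (Q := fun s' => s' = s) hL rfl).mono (by omega) ?_
    rintro s' - rfl
    refine ⟨h14, R, g, hg, hR, hI, Or.inr ⟨rfl, ?_⟩⟩
    rintro ⟨p, hp⟩
    simp [h14, hR u, hp.mem] at h
  have huR : u ∈ R := by
    by_contra h'
    simp [h14, hR u, h'] at h
  let A : Finset (Fin k) := {v | v ∈ R ∧ T.Adj u v}
  let f : ℕ → ℕ := fun v => s.arr 4 v * s.arr 0 (u * k + v)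
  have hf : ∀ v : Fin k, f v = if v ∈ R ∧ T.Adj u v then 1 else 0 := by
    intro v
    simp only [f, hR v, hs.arr0 u v, ite_and]
    split_ifs <;> simp
  have hfle : ∀ v < k, f v ≤ 1 := by
    intro v hv
    have := hf ⟨v, hv⟩
    simp only at this
    rw [this]
    split_ifs <;> simp
  have hsum1 : ∑ v ∈ range k, f v = #A := by
    rw [Finset.sum_range, card_filter]
    exact sum_congr rfl fun v _ => hf v
  have hsum2 : ∑ v ∈ range k, f v * v = ∑ v ∈ A, (v : ℕ) := by
    rw [Finset.sum_range, sum_filter]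
    refine sum_congr rfl fun v _ => ?_
    rw [hf v]
    split_ifs <;> simp
  have hb1 : ∀ i ≤ k, ∑ v ∈ range i, f v ≤ k := by
    intro i hi
    calc _ ≤ ∑ _v ∈ range i, 1 := sum_le_sum fun v hv => hfle v (by simp at hv; omega)
      _ ≤ k := by simpa using hi
  have hb2 : ∀ i ≤ k, ∑ v ∈ range i, f v * v ≤ k ^ 2 := by
    intro i hi
    calc _ ≤ ∑ _v ∈ range i, k := sum_le_sum fun v hv => by
          have := hfle v (by simp at hv; omega)
          simp at hv
          nlinarith
      _ ≤ k ^ 2 := by simp; nlinarith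
  refine (Runs.assign_seq (N := k * (2 + 2) + 2 + (3 * n ^ 2 + 6 * n + 4) + 1) hL (by simp)
    (Runs.assign_seq hL (by simp) ?_)).mono (by omega) (fun _ _ h => h)
  set s₀ := (s.setReg 19 ((Expr.lit 0).val s)).setReg 20
    ((Expr.lit 0).val (s.setReg 19 ((Expr.lit 0).val s))) with hs₀
  refine Runs.seq (Q₁ := fun s' => s'.reg 19 = #A ∧ s'.reg 20 = ∑ v ∈ A, (v : ℕ))
    ((Runs.forTo hL (m := k) (N := 2) (fun i s' => s'.reg 19 = ∑ v ∈ range i, f v ∧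
      s'.reg 20 = ∑ v ∈ range i, f v * v) (by omega) ?_ ?_ ?_).mono le_rfl ?_) ?_
  · intro s' h
    have := h.reg 0 (by decide)
    simp [hs₀] at this
    simp [this, hs.reg0]
  · simp [hs₀]
  · rintro i hi s₂ h2 h21 ⟨h19, h20⟩
    have e0 := h2.reg 0 (by decide)
    have e14 := h2.reg 14 (by decide)
    have a0 := h2.arr 0 (by decide)
    have a4 := h2.arr 4 (by decide)
    simp [hs₀, hs.reg0, h14] at e0 e14 a0 a4
    have hv1 : s₂.reg 19 + s₂.arr 4 i * s₂.arr 0 (u * k + i) = ∑ v ∈ range (i + 1), f v := by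
      rw [sum_range_succ, h19, a0, a4]
    have hv2 : s₂.reg 20 + s₂.arr 4 i * s₂.arr 0 (u * k + i) * i =
        ∑ v ∈ range (i + 1), f v * v := by
      rw [sum_range_succ, h20, a0, a4]
    have h1 := hb1 (i + 1) hi
    have h2 := hb2 (i + 1) hi
    refine Runs.assign_seq hL ?_ (Runs.assign hL ?_ ?_)
    · simp [h21, e14, e0, hv1]
      omega
    · simp [h21, e14, e0, hv2]
      omega
    · simp [h21, e14, e0, hv1, hv2]
  · rintro s' - ⟨h, -⟩
    rwa [hsum1, hsum2] at h
  · rintro s₁ h1 ⟨h19, h20⟩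
    have e14 := h1.reg 14 (by decide)
    have a4 := h1.arr 4 (by decide)
    have a5 := h1.arr 5 (by decide)
    simp [hs₀, h14] at e14 a4 a5
    have hIn : HasInput T G s₁ := by
      refine HasInput.of_agree ?_ h1 (by decide) (by decide) (by decide) (by decide)
      exact ⟨by simp [hs₀, hs.reg0], by simp [hs₀, hs.reg1], hs.arr0, hs.arr1⟩
    have hg₁ : HasTable g s₁ := fun a v => by rw [a5, hg]
    have hR₁ : HasMarks R s₁ := fun a => by rw [a4, hR]
    refine Runs.cond (N := 3 * n ^ 2 + 6 * n + 3) hL (fun h => ?_) (fun h => ?_)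
    · have hA : #A = 1 := by
        simp only [Expr.val_mul, Expr.val_sub, Expr.val_lit, Expr.val_reg, h19] at h
        have h5 := left_ne_zero_of_mul h
        have h6 := right_ne_zero_of_mul h
        omega
      obtain ⟨p, hp⟩ := card_eq_one.1 hA
      have hpA : ∀ v, v ∈ R ∧ T.Adj u v ↔ v = p := fun v => by
        rw [← mem_singleton, ← hp]; simp [A]
      have hl : IsLeaf T R u p := ⟨huR, ((hpA p).2 rfl).1, ((hpA p).2 rfl).2,
        fun v hv hv' => (hpA v).1 ⟨hv, hv'⟩⟩
      have hI' := hI.eliminate hl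
      refine (contract_spec hL hn hIn hg₁ hR₁ hl.adj.ne' e14 (by simp [h20, hp])
        (fun v => (hI.mul_le hB u v).trans_lt hBL) fun v => (hI'.le hB p v).trans_lt hBL).mono
        le_rfl ?_
      rintro s' h ⟨h7, h8⟩
      exact ⟨(h.reg 14 (by decide)).trans e14, _, _, h7, h8, hI', Or.inl (card_erase_lt_of_mem huR)⟩
    · refine (Runs.skip (Q := fun s' => s' = s₁) hL rfl).mono (by omega) ?_
      rintro s' - rfl
      refine ⟨e14, R, g, hg₁, hR₁, hI, Or.inr ⟨rfl, ?_⟩⟩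
      rintro ⟨p, hp⟩
      have hA : A = {p} := by
        ext v
        simp only [A, mem_filter, mem_univ, true_and, mem_singleton]
        exact ⟨fun hv => hp.unique v hv.1 hv.2, fun hv => hv ▸ ⟨hp.mem', hp.adj⟩⟩
      simp [h19, hA] at h

/-- A pass over all nodes either removes a node or shows that no node is a leaf. The latter is
impossible while the remaining tree has two nodes, so `k` passes suffice. -/
lemma eliminateLeaves_spec (hL : 0 < L) (hn : n < 2 ^ L) (hk : k ^ 2 < 2 ^ L) {w : ℕ → ℕ} {B : ℕ}
    (hB : 0 < B) (hBL : B ^ k < 2 ^ L) (hs : HasInput T G s) {g : Fin k → Fin n → ℕ}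
    (hg : HasTable g s) {R : Finset (Fin k)} (hR : HasMarks R s) (hI : Inv T G w B R g) :
    Runs L eliminateLeaves s (k * (k * (3 * n ^ 2 + 6 * n + 4 * k + 11) + 4) + 2) fun s' =>
      ∃ R' g', HasTable g' s' ∧ HasMarks R' s' ∧ Inv T G w B R' g' ∧ #R' ≤ 1 := by
  have hkk : k ≤ k ^ 2 := Nat.le_self_pow (by norm_num) k
  refine (Runs.forTo hL (m := k) (N := k * (3 * n ^ 2 + 6 * n + 4 * k + 11) + 2)
    (fun j s' => ∃ R' g', HasTable g' s' ∧ HasMarks R' s' ∧ Inv T G w B R' g' ∧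
      #R' ≤ max 1 (k - j)) (by omega) ?_ ?_ ?_).mono le_rfl ?_
  · intro s' h
    exact (hs.of_agree h (by decide) (by decide) (by decide) (by decide)).reg0
  · exact ⟨R, g, hg, hR, hI, by have := card_le_univ R; simp at this; omega⟩
  · rintro j hj s₁ h1 h18 ⟨R₁, g₁, hg₁, hR₁, hI₁, hc₁⟩
    have hIn := hs.of_agree h1 (by decide) (by decide) (by decide) (by decide)
    refine (Runs.forTo hL (m := k) (N := 3 * n ^ 2 + 6 * n + 4 * k + 9)
      (fun i s' => ∃ R' g', HasTable g' s' ∧ HasMarks R' s' ∧ Inv T G w B R' g' ∧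
        (#R' < #R₁ ∨ R' = R₁ ∧ ∀ u : Fin k, u < i → ¬ ∃ p, IsLeaf T R₁ u p))
      (by omega) ?_ ?_ ?_).mono le_rfl ?_
    · intro s' h
      exact (hIn.of_agree h (by decide) (by decide) (by decide) (by decide)).reg0
    · exact ⟨R₁, g₁, hg₁, hR₁, hI₁, Or.inr ⟨rfl, by simp⟩⟩
    · rintro i hi s₂ h2 h14 ⟨R₂, g₂, hg₂, hR₂, hI₂, hc₂⟩
      refine (contractIfLeaf_spec hL hn hk hB hBL
        (hIn.of_agree h2 (by decide) (by decide) (by decide) (by decide)) hg₂ hR₂ hI₂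
        (u := ⟨i, hi⟩) h14).mono le_rfl ?_
      rintro s' - ⟨h3, R₃, g₃, hg₃, hR₃, hI₃, hc₃⟩
      refine ⟨h3, R₃, g₃, hg₃, hR₃, hI₃, ?_⟩
      rcases hc₂ with hc₂ | ⟨rfl, hc₂⟩
      · refine Or.inl ?_
        rcases hc₃ with hc₃ | ⟨rfl, -⟩ <;> omega
      · rcases hc₃ with hc₃ | ⟨rfl, hc₃⟩
        · exact Or.inl hc₃
        · refine Or.inr ⟨rfl, fun u hu => ?_⟩
          rcases Nat.lt_succ_iff_lt_or_eq.1 hu with h | h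
          · exact hc₂ u h
          · obtain rfl : u = ⟨i, hi⟩ := Fin.ext h
            exact hc₃
    · rintro s' h3 ⟨⟨R₂, g₂, hg₂, hR₂, hI₂, hc₂⟩, -⟩
      refine ⟨(h3.reg 18 (by decide)).trans h18, R₂, g₂, hg₂, hR₂, hI₂, ?_⟩
      rcases hc₂ with hc₂ | ⟨rfl, hc₂⟩
      · omega
      · by_contra hcon
        obtain ⟨u, p, hup⟩ := exists_isLeaf hI₂.isTree (by omega)
        exact hc₂ u u.2 ⟨p, hup⟩
  · rintro s' - ⟨⟨R', g', h1, h2, h3, h4⟩, -⟩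
    exact ⟨R', g', h1, h2, h3, by omega⟩

lemma initElimination_spec (hL : 0 < L) (hn : n < 2 ^ L) (hk : k < 2 ^ L) (hs : HasInput T G s)
    {w : ℕ → ℕ} (hw : ∀ v < n, s.arr 3 v = w v) :
    Runs L initElimination s (k * (3 * n + 5) + 2) fun s' =>
      HasTable (fun (_ : Fin k) (v : Fin n) => w v) s' ∧
        HasMarks (univ : Finset (Fin k)) s' := by
  refine (Runs.forTo hL (m := k) (N := 3 * n + 3) (fun j s' =>
    (∀ (u : Fin k) (v : Fin n), (u : ℕ) < j → s'.arr 5 (u * n + v) = w v) ∧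
      ∀ u : Fin k, (u : ℕ) < j → s'.arr 4 u = 1) hk ?_ (by simp) ?_).mono le_rfl ?_
  · intro s' h
    exact (hs.of_agree h (by decide) (by decide) (by decide) (by decide)).reg0
  · rintro j hj s₁ h1 h14 ⟨hI, hI'⟩
    have hIn := hs.of_agree h1 (by decide) (by decide) (by decide) (by decide)
    refine (Runs.store_seq (N := n * (1 + 2) + 2) hL (by simp [Nat.one_lt_two_pow hL.ne']) ?_).mono
      (by omega) (fun _ _ h => h)
    set s₂ := s₁.setArr 4 ((Expr.reg 14).val s₁) ((Expr.lit 1).val s₁) with hs₂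
    refine (Runs.forTo hL (m := n) (N := 1) (fun i s' => ∀ (u : Fin k) (v : Fin n),
      ((u : ℕ) < j ∨ (u : ℕ) = j ∧ (v : ℕ) < i) → s'.arr 5 (u * n + v) = w v) hn
      ?_ ?_ ?_).mono le_rfl ?_
    · intro s' h
      have := h.reg 1 (by decide)
      simpa [hs₂, hIn.reg1] using this
    · intro u v huv
      simpa [hs₂] using hI u v (by simpa using huv)
    · intro i hi s₃ h3 h15 hI₃
      have e1 := h3.reg 1 (by decide)
      have e14 := h3.reg 14 (by decide)
      have a3 : s₃.arr 3 i = s.arr 3 i := by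
        rw [h3.arr 3 (by decide)]
        simp [hs₂, h1.arr 3 (by decide)]
      simp [hs₂, hIn.reg1, h14] at e1 e14
      refine Runs.of_bounded fun hb => Runs.store hL ?_ ?_
      · simpa using hb.2 _ _
      · refine ⟨by simpa using h15, fun u v huv => ?_⟩
        simp only [State.arr_setReg, State.arr_setArr, true_and, Expr.val_add, Expr.val_mul,
          Expr.val_reg, Expr.val_get, e14, e1, h15, mul_add_inj v.2 hi, a3]
        split_ifs with h
        · rw [h.2, hw i hi]
        · exact hI₃ u v (by omega)
    · rintro s' h3 ⟨hI₃, -⟩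
      have e14 := h3.reg 14 (by decide)
      have a4 := h3.arr 4 (by decide)
      simp [hs₂, h14] at e14
      refine ⟨e14, fun u v huv => hI₃ u v ?_, fun u hu => ?_⟩
      · have := v.2; omega
      · have hu' : (u : ℕ) = j ∨ (u : ℕ) < j := by omega
        rw [State.arr_setReg, a4]
        simp only [hs₂, State.arr_setArr, Expr.val_reg, h14, true_and, Expr.val_lit]
        split_ifs with h
        · rfl
        · exact hI' u (by omega)
  · rintro s' - ⟨⟨h1, h2⟩, -⟩
    exact ⟨fun u v => h1 u v u.2, fun u => by simpa using h2 u u.2⟩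

lemma collect_spec (hL : 0 < L) (hn : n < 2 ^ L) (hk : k < 2 ^ L) (hs : HasInput T G s)
    {g : Fin k → Fin n → ℕ} (hg : HasTable g s) {R : Finset (Fin k)} (hR : HasMarks R s)
    (hb : ∑ u ∈ R, ∑ v, g u v < 2 ^ L) :
    Runs L collect s (k * (3 * n + 4) + 3) fun s' => s'.reg 22 = ∑ u ∈ R, ∑ v, g u v := by
  classical
  let f : ℕ → ℕ → ℕ := fun u v => s.arr 4 u * s.arr 5 (u * n + v)
  have hf : ∑ u ∈ range k, ∑ v ∈ range n, f u v = ∑ u ∈ R, ∑ v, g u v := by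
    rw [Finset.sum_range, ← sum_subset (subset_univ R)]
    · refine sum_congr rfl fun u hu => ?_
      rw [Finset.sum_range]
      exact sum_congr rfl fun v _ => by simp [f, hR u, hu, hg u v]
    · intro u _ hu
      exact sum_eq_zero fun v _ => by simp [f, hR u, hu]
  rw [← hf] at hb ⊢
  have hb' : ∀ j < k, ∀ i ≤ n,
      ∑ u ∈ range j, ∑ v ∈ range n, f u v + ∑ v ∈ range i, f j v < 2 ^ L := by
    intro j hj i hi
    refine lt_of_le_of_lt ?_ hb
    calc _ ≤ ∑ u ∈ range j, ∑ v ∈ range n, f u v + ∑ v ∈ range n, f j v :=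
          Nat.add_le_add_left (sum_le_sum_of_subset (range_subset_range.2 hi)) _
      _ = ∑ u ∈ range (j + 1), ∑ v ∈ range n, f u v := by rw [sum_range_succ]
      _ ≤ _ := sum_le_sum_of_subset (range_subset_range.2 hj)
  refine (Runs.assign_seq (N := k * (n * (1 + 2) + 2 + 2) + 2) hL (by simp) ?_).mono
    (by nlinarith) (fun _ _ h => h)
  set s₀ := s.setReg 22 ((Expr.lit 0).val s) with hs₀
  have hs₀I : HasInput T G s₀ := ⟨by simp [hs₀, hs.reg0], by simp [hs₀, hs.reg1], hs.arr0, hs.arr1⟩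
  refine (Runs.forTo hL (m := k) (N := n * (1 + 2) + 2) (fun j s' =>
    s'.reg 22 = ∑ u ∈ range j, ∑ v ∈ range n, f u v) hk ?_ (by simp [hs₀]) ?_).mono le_rfl
    (fun _ _ h => h.1)
  · intro s' h
    exact (hs₀I.of_agree h (by decide) (by decide) (by decide) (by decide)).reg0
  · intro j hj s₁ h1 h14 hI
    have hIn := hs₀I.of_agree h1 (by decide) (by decide) (by decide) (by decide)
    refine (Runs.forTo hL (m := n) (N := 1) (fun i s' => s'.reg 22 =
      ∑ u ∈ range j, ∑ v ∈ range n, f u v + ∑ v ∈ range i, f j v) hn ?_ (by simpa using hI) ?_).mono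
      le_rfl ?_
    · intro s' h
      exact (hIn.of_agree h (by decide) (by decide) (by decide) (by decide)).reg1
    · intro i hi s₂ h2 h15 hI₂
      have e1 := h2.reg 1 (by decide)
      have e14 := h2.reg 14 (by decide)
      have a4 := (h2.arr 4 (by decide)).trans (h1.arr 4 (by decide))
      have a5 := (h2.arr 5 (by decide)).trans (h1.arr 5 (by decide))
      simp [hIn.reg1, h14, hs₀] at e1 e14 a4 a5
      have hval : s₂.reg 22 + s₂.arr 4 j * s₂.arr 5 (j * n + i) =
          ∑ u ∈ range j, ∑ v ∈ range n, f u v + ∑ v ∈ range (i + 1), f j v := by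
        rw [sum_range_succ, hI₂, a4, a5, add_assoc]
      refine Runs.assign hL ?_ ?_
      · simp only [Expr.val_add, Expr.val_reg, Expr.val_mul, Expr.val_get, e1, e14, h15, hval]
        exact hb' j hj _ hi
      · simp [e1, e14, h15, hval]
    · rintro s' h2 ⟨hI₂, -⟩
      have e14 := h2.reg 14 (by decide)
      refine ⟨e14.trans h14, ?_⟩
      simp [hI₂, sum_range_succ]

lemma evalHomSum_spec (hT : T.IsTree) (hn0 : 0 < n) (hL : 0 < L) (hn : n < 2 ^ L)
    (hk : k ^ 2 < 2 ^ L) (hs : HasInput T G s) {w : ℕ → ℕ} {B : ℕ}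
    (hw : ∀ v < n, n * w v ≤ B) (hw' : ∀ v < n, s.arr 3 v = w v) (hB : 0 < B)
    (hBL : B ^ k < 2 ^ L) {q : ℕ} (hnq : n ≤ q) (hkq : k ≤ q) (hsum : homSum T G w < 2 ^ L) :
    Runs L evalHomSum s (60 * (q + 1) ^ 4) fun s' => s'.reg 22 = homSum T G w := by
  have hkk : k ≤ k ^ 2 := Nat.le_self_pow (by norm_num) k
  have htime : (k * (3 * n + 5) + 2) + ((k * (k * (3 * n ^ 2 + 6 * n + 4 * k + 11) + 4) + 2) +
      (k * (3 * n + 4) + 3)) ≤ 60 * (q + 1) ^ 4 := by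
    calc _ ≤ (q * (3 * q + 5) + 2) + ((q * (q * (3 * q ^ 2 + 6 * q + 4 * q + 11) + 4) + 2) +
          (q * (3 * q + 4) + 3)) := by gcongr
      _ ≤ _ := by ring_nf; nlinarith [Nat.zero_le (q ^ 4), Nat.zero_le (q ^ 3), Nat.zero_le (q ^ 2)]
  refine (Runs.seq (initElimination_spec hL hn (by omega) hs hw') fun s₁ h1 hQ => ?_).mono htime
    (fun _ _ h => h)
  have hs₁ := hs.of_agree h1 (by decide) (by decide) (by decide) (by decide)
  refine Runs.seq (eliminateLeaves_spec hL hn hk hB hBL hs₁ hQ.1 hQ.2 (Inv.init hT hw))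
    fun s₂ h2 => ?_
  rintro ⟨R, g, hg, hR, hI, hc⟩
  have hs₂ := hs₁.of_agree h2 (by decide) (by decide) (by decide) (by decide)
  have h3 := hI.sum_of_card_le_one hn0 hc
  rw [← h3] at hsum ⊢
  exact collect_spec hL hn (by omega) hs₂ hg hR hsum

/-! ### The sum over all masks

Registers: `2` is the modulus `M`, `3` the sum, `4` the current mask, `5` is `2 ^ n`, `7` the number
of ones in the mask, `8` the power of `M - 1`. Array `2` holds the weights. -/

open RAM.Expr in
/-- Table of the weights in array `2`. -/
def computeWeights : Prog :=
  .seq (.assign 11 (lit 1)) (.seq (.assign 12 (lit 0))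
    (.forTo 13 (reg 0 / lit 2 + lit 1)
      (.seq (.store 2 (reg 13) (reg 11 + (lit 1 - (reg 0 - reg 0 / lit 2 * lit 2)) * reg 12))
      (.seq (.assign 12 (reg 11))
        -- The division is exact, by the absorption identity for binomial coefficients; register
        -- `12` keeps the previous coefficient for the second summand of the weight.
        (.assign 11 (reg 11 * (reg 1 - reg 0 + reg 13 + lit 1) / (reg 13 + lit 1)))))))

open RAM.Expr in
/-- Evaluation of the bits of the mask. -/
def readMask : Prog :=
  .seq (.assign 6 (reg 4)) (.seq (.assign 7 (lit 0)) (.seq (.assign 8 (lit 1))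
    (.forTo 9 (reg 1)
      (.seq
        (.cond (reg 6 - reg 6 / lit 2 * lit 2)
          (.seq (.store 3 (reg 9) (reg 2 - lit 1))
            (.seq (.assign 7 (reg 7 + lit 1)) (.assign 8 (reg 8 * (reg 2 - lit 1)))))
          (.store 3 (reg 9) (lit 1)))
        (.assign 6 (reg 6 / lit 2))))))

open RAM.Expr in
/-- The lowest one of the mask, into register `10`. -/
def lowestOne : Prog :=
  .seq (.assign 10 (lit 1))
    -- Continue while the quotient is even. This would never end for the mask `0`, but the routine
    -- is called only for masks with more than `k / 2` ones.
    (.loop (lit 1 - (reg 4 / reg 10 - reg 4 / reg 10 / lit 2 * lit 2))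
      (.assign 10 (reg 10 * lit 2)))

open RAM.Expr in
/-- Processing of one mask, and step to the next one. -/
def processMask : Prog :=
  .seq readMask
    (.cond (reg 0 / lit 2 + lit 1 - reg 7)
      (.seq evalHomSum
        (.seq (.assign 3 (reg 3 + reg 8 * get 2 (reg 0 / lit 2 - reg 7) * reg 22))
          (.assign 4 (reg 4 + lit 1))))
      (.seq lowestOne (.assign 4 (reg 4 + reg 10))))

open RAM.Expr in
/-- The sum over all masks, into register `3`. -/
def sumMasks : Prog :=
  .seq computeWeights
    (.seq (.seq (.assign 5 (lit 1)) (.forTo 9 (reg 1) (.assign 5 (reg 5 * lit 2))))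
      (.seq (.assign 3 (lit 0)) (.seq (.assign 4 (lit 0))
        (.loop (reg 5 - reg 4) processMask))))

/-- All numbers in the computation have at most `L` bits. -/
structure Fits (k n M L : ℕ) : Prop where
  n_pos : 0 < n
  k_le : k ≤ n
  n_le : n + 3 ≤ L
  k_sq : k ^ 2 < 2 ^ L
  M_pos : 0 < M
  pow_n : M ^ n < 2 ^ L
  pow_k : (n * M) ^ k < 2 ^ L

variable {M : ℕ}

lemma Fits.pos (h : Fits k n M L) : 0 < L := by have := h.n_le; omega

lemma Fits.n_lt (h : Fits k n M L) : n < 2 ^ L :=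
  (show n < L by have := h.n_le; omega).trans Nat.lt_two_pow_self

lemma Fits.M_lt (h : Fits k n M L) : M < 2 ^ L :=
  (Nat.le_self_pow h.n_pos.ne' M).trans_lt h.pow_n

/-- Array `2` holds the weights. -/
def HasWeights (k n : ℕ) (s : State) : Prop := ∀ r ≤ k / 2, s.arr 2 r = maskWeight n k r

lemma computeWeights_spec (hF : Fits k n M L) (hs : HasInput T G s) :
    Runs L computeWeights s (5 * k + 9) (HasWeights k n) := by
  have hL := hF.pos
  have hkn := hF.k_le
  have h1L : 1 < 2 ^ L := Nat.one_lt_two_pow hL.ne'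
  -- The range goes one beyond the last weight because the loop already prepares the next
  -- coefficient; the factor `2` covers a weight that is a sum of two coefficients.
  have hch : ∀ r ≤ k / 2 + 1, 2 * (n - k + r).choose r < 2 ^ L := by
    intro r hr
    calc 2 * (n - k + r).choose r ≤ 2 * 2 ^ (n - k + r) :=
          Nat.mul_le_mul_left _ (Nat.choose_le_two_pow _ _)
      _ = 2 ^ (n - k + r + 1) := by ring
      _ < 2 ^ L := Nat.pow_lt_pow_right (by norm_num) (by have := hF.n_le; omega)
  refine (Runs.assign_seq (N := (k / 2 + 1) * (3 + 2) + 2 + 1) hL (by simpa using h1L)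
    (Runs.assign_seq hL (by simp) ?_)).mono (by omega) (fun _ _ h => h)
  set s₀ := (s.setReg 11 ((Expr.lit 1).val s)).setReg 12
    ((Expr.lit 0).val (s.setReg 11 ((Expr.lit 1).val s))) with hs₀
  have hs₀I : HasInput T G s₀ := ⟨by simp [hs₀, hs.reg0], by simp [hs₀, hs.reg1], hs.arr0, hs.arr1⟩
  refine (Runs.forTo hL (m := k / 2 + 1) (N := 3) (fun j s' =>
    s'.reg 11 = (n - k + j).choose j ∧
    s'.reg 12 = (if j = 0 then 0 else (n - k + (j - 1)).choose (j - 1)) ∧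
    ∀ r < j, s'.arr 2 r = maskWeight n k r) ?_ ?_ (by simp [hs₀]) ?_).mono le_rfl ?_
  · have := hF.n_lt; omega
  · intro s' h
    have := (hs₀I.of_agree h (by decide) (by decide) (by decide) (by decide)).reg0
    simp [this]
  · rintro j hj s₁ h1 h13 ⟨h11, h12, hW⟩
    have hIn := hs₀I.of_agree h1 (by decide) (by decide) (by decide) (by decide)
    have hpar : 1 - (k - k / 2 * 2) = 1 - k % 2 := by omega
    have hw : (n - k + j).choose j + (1 - (k - k / 2 * 2)) *
        (if j = 0 then 0 else (n - k + (j - 1)).choose (j - 1)) = maskWeight n k j := by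
      rw [hpar]; rfl
    have hc : (n - k + j).choose j * (n - k + j + 1) / (j + 1) =
        (n - k + (j + 1)).choose (j + 1) := by
      have := Nat.add_one_mul_choose_eq (n - k + j) j
      rw [mul_comm, this]
      exact Nat.mul_div_cancel _ (by omega)
    refine Runs.store_seq (N := 2) hL ?_ (Runs.assign_seq hL ?_ (Runs.assign hL ?_ ?_))
    · have h2 := hch j (by omega)
      have h3 : 2 * (if j = 0 then 0 else (n - k + (j - 1)).choose (j - 1)) < 2 ^ L := by
        split_ifs
        · omega
        · exact hch (j - 1) (by omega)
      simp only [Expr.val_add, Expr.val_mul, Expr.val_sub, Expr.val_div, Expr.val_lit, Expr.val_reg,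
        hIn.reg0, h11, h12]
      rcases Nat.mod_two_eq_zero_or_one k with h | h <;> rw [hpar, h] <;> omega
    · have h2 := hch j (by omega)
      simp [h11]
      omega
    · have h2 := hch (j + 1) (by omega)
      simp [h11, h13, hIn.reg0, hIn.reg1, hc]
      omega
    · simp only [Expr.val_add, Expr.val_mul, Expr.val_sub, Expr.val_div, Expr.val_lit, Expr.val_reg,
        State.reg_setReg, State.reg_setArr, State.arr_setReg, State.arr_setArr, h13, h11, h12,
        hIn.reg0, hIn.reg1, hw]
      simp only [Nat.reduceEqDiff, if_true, if_false, true_and]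
      refine ⟨hc, by simp, fun r hr => ?_⟩
      split_ifs with h
      · rw [h]
      · exact hW r (by omega)
  · rintro s' - ⟨⟨-, -, h⟩, -⟩
    exact fun r hr => h r (by omega)

/-- The weights that belong to a mask. -/
def maskValue (M x v : ℕ) : ℕ := if x / 2 ^ v % 2 = 1 then M - 1 else 1

lemma readMask_spec (hF : Fits k n M L) (hs : HasInput T G s) (h2 : s.reg 2 = M) {x : ℕ}
    (h4 : s.reg 4 = x) (hx : x < 2 ^ n) :
    Runs L readMask s (7 * n + 5) fun s' => s'.reg 7 = binaryOnes x ∧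
      s'.reg 8 = (M - 1) ^ binaryOnes x ∧ ∀ v < n, s'.arr 3 v = maskValue M x v := by
  have hL := hF.pos
  have h1L : 1 < 2 ^ L := Nat.one_lt_two_pow hL.ne'
  have hxL : x < 2 ^ L := hx.trans (Nat.pow_lt_pow_right (by norm_num) (by have := hF.n_le; omega))
  have hle : ∀ j ≤ n, ∑ v ∈ range j, x / 2 ^ v % 2 ≤ n := by
    intro j hj
    calc _ ≤ ∑ _v ∈ range j, 1 := sum_le_sum fun v _ => by omega
      _ ≤ n := by simpa using hj
  have hpow : ∀ i ≤ n, (M - 1) ^ i < 2 ^ L := by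
    intro i hi
    refine lt_of_le_of_lt ?_ hF.pow_n
    exact (Nat.pow_le_pow_left (Nat.sub_le _ _) i).trans (Nat.pow_le_pow_right hF.M_pos hi)
  refine (Runs.assign_seq (N := n * (5 + 2) + 2 + 1 + 1) hL (by simpa [h4] using hxL)
    (Runs.assign_seq hL (by simp) (Runs.assign_seq hL (by simpa using h1L) ?_))).mono (by omega)
    (fun _ _ h => h)
  simp only [Expr.val_lit, Expr.val_reg, h4]
  set s₀ := ((s.setReg 6 x).setReg 7 0).setReg 8 1 with hs₀
  have hs₀I : HasInput T G s₀ := ⟨by simp [hs₀, hs.reg0], by simp [hs₀, hs.reg1], hs.arr0, hs.arr1⟩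
  refine (Runs.forTo hL (m := n) (N := 5) (fun j s' => s'.reg 6 = x / 2 ^ j ∧
    s'.reg 7 = ∑ v ∈ range j, x / 2 ^ v % 2 ∧
    s'.reg 8 = (M - 1) ^ (∑ v ∈ range j, x / 2 ^ v % 2) ∧
    ∀ v < j, s'.arr 3 v = maskValue M x v) hF.n_lt ?_ (by simp [hs₀]) ?_).mono le_rfl ?_
  · intro s' h
    exact (hs₀I.of_agree h (by decide) (by decide) (by decide) (by decide)).reg1
  · rintro j hj s₁ h1 h9 ⟨h6, h7, h8, h3⟩
    have e2 := h1.reg 2 (by decide)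
    simp [hs₀, h2] at e2
    refine Runs.seq (N₁ := 4) (N₂ := 1) (Q₁ := fun s' => s'.reg 6 = x / 2 ^ j ∧ s'.reg 9 = j ∧
      s'.reg 7 = ∑ v ∈ range (j + 1), x / 2 ^ v % 2 ∧
      s'.reg 8 = (M - 1) ^ (∑ v ∈ range (j + 1), x / 2 ^ v % 2) ∧
      ∀ v < j + 1, s'.arr 3 v = maskValue M x v) ?_ ?_
    · have hle' := hle (j + 1) hj
      rw [sum_range_succ] at hle' ⊢
      refine Runs.cond (N := 3) hL (fun h => ?_) (fun h => ?_)
      · have hbit : x / 2 ^ j % 2 = 1 := by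
          simp only [Expr.val_sub, Expr.val_reg, Expr.val_mul, Expr.val_div, Expr.val_lit, h6] at h
          omega
        rw [hbit] at hle' ⊢
        refine Runs.store_seq (N := 2) hL ?_ (Runs.assign_seq hL ?_ (Runs.assign hL ?_ ?_))
        · have := hF.M_lt
          simp [e2]
          omega
        · have := hF.n_lt
          simp [h7]
          omega
        · simp [h8, e2, ← pow_succ]
          exact hpow _ hle'
        · simp [h6, h7, h8, h9, e2, pow_succ]
          intro v hv
          split_ifs with h'
          · simp [maskValue, h', hbit]
          · exact h3 v (by omega)
      · have hbit : x / 2 ^ j % 2 = 0 := by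
          simp only [Expr.val_sub, Expr.val_reg, Expr.val_mul, Expr.val_div, Expr.val_lit, h6] at h
          omega
        rw [hbit]
        refine (Runs.store hL (by simpa using h1L) ?_).mono (by omega) (fun _ _ h => h)
        simp [h6, h7, h8, h9]
        intro v hv
        split_ifs with h'
        · simp [maskValue, h', hbit]
        · exact h3 v (by omega)
    · rintro s₂ - ⟨h6, h9, h7, h8, h3⟩
      refine Runs.assign hL ?_ ?_
      · have : x / 2 ^ j / 2 ≤ x := (Nat.div_le_self _ _).trans (Nat.div_le_self _ _)
        simp [h6]
        omega
      · simp [h6, h7, h8, h9, pow_succ, Nat.div_div_eq_div_mul]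
        exact fun v hv => h3 v (by omega)
  · rintro s' - ⟨⟨-, h7, h8, h3⟩, -⟩
    rw [sum_bits_eq_binaryOnes n x hx] at h7 h8
    exact ⟨h7, h8, h3⟩

lemma lowestOne_spec (hL : n < L) {x : ℕ} (h4 : s.reg 4 = x) (hx : x < 2 ^ n) (hx0 : 0 < x) :
    Runs L lowestOne s (2 * n + 2) fun s' => ∃ e q, s'.reg 10 = 2 ^ e ∧ x = q * 2 ^ e ∧
      q % 2 = 1 := by
  have hL0 : 0 < L := by omega
  refine (Runs.assign_seq (N := 2 * n + 1) hL0 (by simp; omega) ?_).mono (by omega)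
    (fun _ _ h => h)
  set s₀ := s.setReg 10 ((Expr.lit 1).val s) with hs₀
  refine (Runs.loop hL0 (fun s' => ∃ e q, s'.reg 10 = 2 ^ e ∧ x = q * 2 ^ e)
    (fun s' => 2 * (n - Nat.log 2 (s'.reg 10))) ⟨0, x, by simp [hs₀], by simp⟩ ?_).mono ?_ ?_
  · rintro s₁ h1 ⟨e, q, h10, hq⟩ h
    have e4 := h1.reg 4 (by decide)
    simp [hs₀, h4] at e4
    have hp : 0 < 2 ^ e := by positivity
    have hq0 : 0 < q := Nat.pos_of_ne_zero (by rintro rfl; simp at hq; omega)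
    have he : e < n := by
      refine (Nat.pow_lt_pow_iff_right (show 1 < 2 by norm_num)).1 (lt_of_le_of_lt ?_ hx)
      rw [hq]
      exact Nat.le_mul_of_pos_left _ hq0
    simp only [Expr.val_sub, Expr.val_reg, Expr.val_mul, Expr.val_div, Expr.val_lit, e4, h10] at h
    rw [hq, Nat.mul_div_cancel _ hp] at h
    refine ⟨1, Runs.assign hL0 ?_ ?_⟩
    · simp only [Expr.val_reg, Expr.val_mul, Expr.val_lit, h10, ← pow_succ]
      exact Nat.pow_lt_pow_right (by norm_num) (by omega)
    · simp only [Expr.val_reg, Expr.val_mul, Expr.val_lit, h10, ← pow_succ, State.reg_setReg,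
        if_true]
      refine ⟨⟨e + 1, q / 2, rfl, ?_⟩, ?_⟩
      · rw [hq, pow_succ', ← mul_assoc]
        congr 1
        omega
      · rw [Nat.log_pow (by norm_num), Nat.log_pow (by norm_num)]
        omega
  · simp [hs₀]
  · rintro s' h1 ⟨⟨e, q, h10, hq⟩, h⟩
    have e4 := h1.reg 4 (by decide)
    simp [hs₀, h4] at e4
    have hp : 0 < 2 ^ e := by positivity
    simp only [Expr.val_sub, Expr.val_reg, Expr.val_mul, Expr.val_div, Expr.val_lit, e4, h10] at h
    rw [hq, Nat.mul_div_cancel _ hp] at h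
    exact ⟨e, q, h10, hq, by omega⟩

/-- The contribution of a mask. -/
noncomputable def maskTerm (T : SimpleGraph (Fin k)) (G : SimpleGraph (Fin n)) (M x : ℕ) : ℕ :=
  if binaryOnes x ≤ k / 2 then (M - 1) ^ binaryOnes x * maskWeight n k (k / 2 - binaryOnes x) *
    homSum T G (maskValue M x) else 0

lemma maskSum_eq_sum_maskTerm (T : SimpleGraph (Fin k)) (G : SimpleGraph (Fin n)) (M : ℕ) :
    maskSum T G (M - 1) = ∑ x ∈ range (2 ^ n), maskTerm T G M x := rfl

lemma homSum_maskValue_le (hM : 0 < M) (x : ℕ) : homSum T G (maskValue M x) ≤ (n * M) ^ k := by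
  classical
  rw [homSum]
  calc _ ≤ ∑ _φ : Fin k → Fin n, M ^ k := sum_le_sum fun φ _ => by
        split_ifs
        · calc _ ≤ ∏ _u : Fin k, M := prod_le_prod' fun u _ => by
                simp only [maskValue]; split_ifs <;> omega
            _ = M ^ k := by simp
        · simp
    _ = (n * M) ^ k := by simp [mul_pow]

/-- Invariant of the loop over the masks. -/
structure MaskInv (T : SimpleGraph (Fin k)) (G : SimpleGraph (Fin n)) (M : ℕ) (s : State) :
    Prop where
  input : HasInput T G s
  weights : HasWeights k n s
  reg2 : s.reg 2 = M
  reg5 : s.reg 5 = 2 ^ n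
  le : s.reg 4 ≤ 2 ^ n
  -- This bounds the number of visited masks and hence the running time.
  ones : binaryOnes (s.reg 4) ≤ k / 2 + 1
  sum : s.reg 3 = ∑ x ∈ range (s.reg 4), maskTerm T G M x

lemma processMask_spec (hT : T.IsTree) (hF : Fits k n M L) (hS : maskSum T G (M - 1) < 2 ^ L)
    (hI : MaskInv T G M s) (h4 : s.reg 4 < 2 ^ n) {q : ℕ} (hnq : n ≤ q) :
    Runs L processMask s (80 * (q + 1) ^ 4) fun s' => MaskInv T G M s' ∧ s.reg 4 < s'.reg 4 := by
  have hL := hF.pos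
  have hkn := hF.k_le
  have hnL := hF.n_le
  have h2nL : 2 ^ n < 2 ^ L := Nat.pow_lt_pow_right (by norm_num) (by omega)
  obtain ⟨x, hx⟩ : ∃ x, s.reg 4 = x := ⟨_, rfl⟩
  have hones := hI.ones
  have hsum := hI.sum
  rw [hx] at h4 hones hsum ⊢
  have hpq : (q + 1) ≤ (q + 1) ^ 4 := Nat.le_self_pow (by norm_num) _
  have htime : (7 * n + 5) + (60 * (q + 1) ^ 4 + 2 + 2 * n + 1) ≤ 80 * (q + 1) ^ 4 := by omega
  refine (Runs.seq (readMask_spec hF hI.input hI.reg2 hx h4) fun s₁ h1 => ?_).mono htime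
    (fun _ _ h => h)
  rintro ⟨h7, h8, h3⟩
  have hIn := hI.input.of_agree h1 (by decide) (by decide) (by decide) (by decide)
  have e4 := (h1.reg 4 (by decide)).trans hx
  refine Runs.cond hL (fun h => ?_) (fun h => ?_)
  · have hle : binaryOnes x ≤ k / 2 := by
      simp only [Expr.val_sub, Expr.val_add, Expr.val_div, Expr.val_reg, Expr.val_lit, hIn.reg0,
        h7] at h
      omega
    refine (Runs.seq (N₂ := 2) (evalHomSum_spec hT hF.n_pos hL hF.n_lt hF.k_sq hIn
      (w := maskValue M x) (B := n * M) (q := q) ?_ h3 (Nat.mul_pos hF.n_pos hF.M_pos) hF.pow_k hnq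
      (by omega) ((homSum_maskValue_le hF.M_pos x).trans_lt hF.pow_k)) fun s₂ h2 h22 => ?_).mono
      (by omega) ?_ (Q₁ := fun s' => s'.reg 4 = x + 1 ∧ s'.reg 3 = ∑ y ∈ range (x + 1), maskTerm T G M y)
    · intro v _
      refine Nat.mul_le_mul_left _ ?_
      have := hF.M_pos
      simp only [maskValue]
      split_ifs <;> omega
    · have hIn₂ := hIn.of_agree h2 (by decide) (by decide) (by decide) (by decide)
      have f3 := (h2.reg 3 (by decide)).trans (h1.reg 3 (by decide))
      have f4 := (h2.reg 4 (by decide)).trans e4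
      have f7 := (h2.reg 7 (by decide)).trans h7
      have f8 := (h2.reg 8 (by decide)).trans h8
      have a2 := (h2.arr 2 (by decide)).trans (h1.arr 2 (by decide))
      have hval : s₂.reg 3 + s₂.reg 8 * s₂.arr 2 (k / 2 - binaryOnes x) * s₂.reg 22 =
          ∑ y ∈ range (x + 1), maskTerm T G M y := by
        rw [sum_range_succ, f3, hsum, f8, a2, h22, hI.weights _ (by omega), maskTerm, if_pos hle]
      have hlt : ∑ y ∈ range (x + 1), maskTerm T G M y < 2 ^ L :=
        (sum_le_sum_of_subset (range_subset_range.2 (by omega))).trans_lt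
          (maskSum_eq_sum_maskTerm T G M ▸ hS)
      refine Runs.assign_seq (N := 1) hL ?_ (Runs.assign hL ?_ ?_)
      · simp only [Expr.val_add, Expr.val_mul, Expr.val_sub, Expr.val_div, Expr.val_lit,
          Expr.val_reg, Expr.val_get, hIn₂.reg0, f7, hval]
        exact hlt
      · simp [f4]
        omega
      · simp only [Expr.val_add, Expr.val_mul, Expr.val_sub, Expr.val_div, Expr.val_lit,
          Expr.val_reg, Expr.val_get, State.reg_setReg, hIn₂.reg0, f7, hval, f4]
        simp
    · rintro s₂ h2 ⟨f4, f3⟩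
      refine ⟨⟨hIn.of_agree h2 (by decide) (by decide) (by decide) (by decide), fun r hr => ?_,
        ?_, ?_, by omega, ?_, by rw [f3, f4]⟩, by omega⟩
      · rw [h2.arr 2 (by decide), h1.arr 2 (by decide)]
        exact hI.weights r hr
      · rw [h2.reg 2 (by decide), h1.reg 2 (by decide), hI.reg2]
      · rw [h2.reg 5 (by decide), h1.reg 5 (by decide), hI.reg5]
      · rw [f4]
        exact (binaryOnes_succ_le x).trans (by omega)
  · have hgt : k / 2 < binaryOnes x := by
      simp only [Expr.val_sub, Expr.val_add, Expr.val_div, Expr.val_reg, Expr.val_lit, hIn.reg0,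
        h7] at h
      omega
    have hx0 : 0 < x := Nat.pos_of_ne_zero (by rintro rfl; simp [binaryOnes] at hgt)
    refine (Runs.seq (N₂ := 1) (lowestOne_spec (by omega) e4 h4 hx0) fun s₂ h2 => ?_).mono
      (by omega) ?_ (Q₁ := fun s' => ∃ e q, s'.reg 4 = (q + 1) * 2 ^ e ∧ x = q * 2 ^ e ∧
        q % 2 = 1 ∧ (q + 1) * 2 ^ e ≤ 2 ^ n)
    · rintro ⟨e, q, h10, hq, hodd⟩
      have f4 := (h2.reg 4 (by decide)).trans e4
      -- The jump cannot pass `2 ^ n`, as that is a multiple of `2 ^ e` larger than `q * 2 ^ e`.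
      have hle : (q + 1) * 2 ^ e ≤ 2 ^ n := by
        have he : e ≤ n := by
          refine (Nat.pow_lt_pow_iff_right (show 1 < 2 by norm_num)).1 (lt_of_le_of_lt ?_ h4) |>.le
          rw [hq]
          exact Nat.le_mul_of_pos_left _ (by omega)
        have h5 : 2 ^ n = 2 ^ (n - e) * 2 ^ e := by rw [← pow_add]; congr 1; omega
        rw [hq, h5] at h4
        rw [h5]
        exact Nat.mul_le_mul_right _ (Nat.lt_of_mul_lt_mul_right h4)
      have hval : s₂.reg 4 + s₂.reg 10 = (q + 1) * 2 ^ e := by rw [f4, h10, hq]; ring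
      refine Runs.assign hL ?_ ⟨e, q, ?_, hq, hodd, hle⟩
      · simp only [Expr.val_add, Expr.val_reg, hval]
        omega
      · simp [hval]
    · rintro s₂ h2 ⟨e, q, f4, hq, hodd, hle⟩
      have hp : 0 < 2 ^ e := by positivity
      have hoq : binaryOnes x = binaryOnes q := by
        simpa [hq, binaryOnes] using binaryOnes_mul_two_pow_add q e 0 hp
      have hxlt : x < s₂.reg 4 := by rw [f4, hq]; nlinarith
      refine ⟨⟨hIn.of_agree h2 (by decide) (by decide) (by decide) (by decide), fun r hr => ?_,
        ?_, ?_, by omega, ?_, ?_⟩, hxlt⟩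
      · rw [h2.arr 2 (by decide), h1.arr 2 (by decide)]
        exact hI.weights r hr
      · rw [h2.reg 2 (by decide), h1.reg 2 (by decide), hI.reg2]
      · rw [h2.reg 5 (by decide), h1.reg 5 (by decide), hI.reg5]
      · have h5 : binaryOnes ((q + 1) * 2 ^ e) = binaryOnes (q + 1) := by
          simpa [binaryOnes] using binaryOnes_mul_two_pow_add (q + 1) e 0 hp
        rw [f4, h5]
        exact (binaryOnes_succ_le_of_odd hodd).trans (hoq ▸ hones)
      · rw [h2.reg 3 (by decide), h1.reg 3 (by decide), hsum]
        -- Every skipped mask is `q * 2 ^ e + d` with `d < 2 ^ e`; it has at least as many ones as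
        -- `x`, so its term is zero.
        refine sum_subset (range_subset_range.2 hxlt.le) fun y hy hyx => ?_
        simp only [mem_range, not_lt, f4] at hy hyx
        rw [maskTerm, if_neg]
        obtain ⟨d, rfl⟩ := Nat.exists_eq_add_of_le hyx
        have hd : d < 2 ^ e := by rw [hq] at hy; nlinarith
        rw [hq, binaryOnes_mul_two_pow_add q e d hd]
        omega

/-- The potential counts the masks with at most `k / 2 + 1` ones from the current one on. The
counter strictly increases through such masks, so each iteration lowers it. -/
lemma sumMasks_spec (hT : T.IsTree) (hF : Fits k n M L) (hS : maskSum T G (M - 1) < 2 ^ L)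
    (hs : HasInput T G s) (h2 : s.reg 2 = M) {q : ℕ} (hnq : n ≤ q) :
    Runs L sumMasks s (110 * (q + 1) ^ 5 * downChoose n (k / 2)) fun s' =>
      s'.reg 3 = maskSum T G (M - 1) := by
  have hL := hF.pos
  have hkn := hF.k_le
  have hnL := hF.n_le
  have h2nL : 2 ^ n < 2 ^ L := Nat.pow_lt_pow_right (by norm_num) (by omega)
  have h1L : 1 < 2 ^ L := Nat.one_lt_two_pow hL.ne'
  set c := 80 * (q + 1) ^ 4 + 1 with hc
  have htime : (5 * k + 9) + ((3 * n + 3) + (downChoose n (k / 2 + 1) * c + 1 + 1 + 1)) ≤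
      110 * (q + 1) ^ 5 * downChoose n (k / 2) := by
    have h3 := downChoose_succ_le n (k / 2)
    have h4 := downChoose_pos n (k / 2)
    set D := downChoose n (k / 2)
    have h6 : q + 1 ≤ (q + 1) ^ 4 := Nat.le_self_pow (by norm_num) _
    have h7 : downChoose n (k / 2 + 1) * c ≤ (q + 1) * D * (81 * (q + 1) ^ 4) :=
      Nat.mul_le_mul (h3.trans (Nat.mul_le_mul_right _ (by omega))) (by omega)
    have h8 : (q + 1) ≤ (q + 1) ^ 5 * D :=
      (Nat.le_self_pow (by norm_num) _).trans (Nat.le_mul_of_pos_right _ h4)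
    have h9 : (q + 1) * D * (81 * (q + 1) ^ 4) = 81 * ((q + 1) ^ 5 * D) := by ring
    rw [mul_assoc]
    omega
  refine (Runs.seq (computeWeights_spec hF hs) fun s₁ h1 hW => ?_).mono htime (fun _ _ h => h)
  have hIn := hs.of_agree h1 (by decide) (by decide) (by decide) (by decide)
  refine Runs.seq (Q₁ := fun s' => s'.reg 5 = 2 ^ n) ?_ fun s₂ h2' h5 => ?_
  · refine (Runs.assign_seq (N := n * (1 + 2) + 2) hL (by simpa using h1L) ?_).mono (by omega)
      (fun _ _ h => h)
    refine (Runs.forTo hL (m := n) (N := 1) (fun j s' => s'.reg 5 = 2 ^ j) hF.n_lt ?_ (by simp)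
      ?_).mono le_rfl (fun _ _ h => h.1)
    · intro s' h
      have := h.reg 1 (by decide)
      simpa [hIn.reg1] using this
    · intro j hj s' h h9 h5
      refine Runs.assign hL ?_ (by simp [h5, h9, pow_succ])
      simp only [Expr.val_mul, Expr.val_reg, Expr.val_lit, h5, ← pow_succ]
      exact Nat.pow_lt_pow_right (by norm_num) (by omega)
  · have hIn₂ := hIn.of_agree h2' (by decide) (by decide) (by decide) (by decide)
    refine Runs.assign_seq hL (by simp) (Runs.assign_seq hL (by simp) ?_)
    set s₃ := (s₂.setReg 3 ((Expr.lit 0).val s₂)).setReg 4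
      ((Expr.lit 0).val (s₂.setReg 3 ((Expr.lit 0).val s₂))) with hs₃
    have e2 : s₂.reg 2 = M := by rw [h2'.reg 2 (by decide), h1.reg 2 (by decide), h2]
    have hI₃ : MaskInv T G M s₃ := by
      refine ⟨⟨by simp [hs₃, hIn₂.reg0], by simp [hs₃, hIn₂.reg1], hIn₂.arr0, hIn₂.arr1⟩, fun r hr => ?_,
        by simp [hs₃, e2], by simp [hs₃, h5], by simp [hs₃], by simp [hs₃, binaryOnes],
        by simp [hs₃]⟩
      simp only [hs₃, State.arr_setReg, h2'.arr 2 (by decide)]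
      exact hW r hr
    refine (Runs.loop hL (MaskInv T G M) (fun s' =>
      #{y ∈ range (2 ^ n) | s'.reg 4 ≤ y ∧ binaryOnes y ≤ k / 2 + 1} * c) hI₃ ?_).mono ?_ ?_
    · intro s' _ hI h
      have hlt : s'.reg 4 < 2 ^ n := by
        simp only [Expr.val_sub, Expr.val_reg, hI.reg5] at h
        omega
      refine ⟨_, (processMask_spec hT hF hS hI hlt hnq).mono le_rfl ?_⟩
      rintro s'' - ⟨hI', hlt'⟩
      refine ⟨hI', ?_⟩
      have hcard : #{y ∈ range (2 ^ n) | s''.reg 4 ≤ y ∧ binaryOnes y ≤ k / 2 + 1} + 1 ≤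
          #{y ∈ range (2 ^ n) | s'.reg 4 ≤ y ∧ binaryOnes y ≤ k / 2 + 1} := by
        refine Nat.succ_le_of_lt (card_lt_card ⟨?_, ?_⟩)
        · intro y hy
          simp only [mem_filter] at hy ⊢
          exact ⟨hy.1, by omega, hy.2.2⟩
        · intro hsub
          have := hsub (mem_filter.2 ⟨mem_range.2 hlt, le_rfl, hI.ones⟩)
          simp only [mem_filter] at this
          omega
      have := Nat.mul_le_mul_right c hcard
      rw [add_mul, one_mul] at this
      omega
    · refine Nat.add_le_add_right (Nat.mul_le_mul_right _ ?_) _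
      rw [← card_binaryOnes_le]
      refine card_le_card fun y hy => ?_
      simp only [mem_filter] at hy ⊢
      exact ⟨hy.1, hy.2.2⟩
    · rintro s' - ⟨hI, h⟩
      have : s'.reg 4 = 2 ^ n := by
        simp only [Expr.val_sub, Expr.val_reg, hI.reg5] at h
        have := hI.le
        omega
      rw [hI.sum, this, maskSum_eq_sum_maskTerm]

/-! ### The algorithm -/

open RAM.Expr in
/-- The modulus `(4 * (n + 1)) ^ k`, into register `2`. -/
def setModulus : Prog :=
  .seq (.assign 2 (lit 1)) (.forTo 9 (reg 0) (.assign 2 (reg 2 * (lit 4 * (reg 1 + lit 1)))))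

open RAM.Expr in
/-- The number of copies of the tree in array `0` in the graph in array `1`, into register `0`. -/
def countCopies : Prog :=
  -- If `k > n` there are no copies; the weight identity needs `k ≤ n`.
  .cond (reg 0 - reg 1) (.assign 0 (lit 0))
    (.seq setModulus (.seq sumMasks
    (.seq (.assign 23 (reg 3 - reg 3 / reg 2 * reg 2))
    -- From here `T` replaces `G` as the host, so that the second run counts automorphisms. The
    -- common factor `4 ^ (k / 2)` cancels in the final quotient.
    (.seq (.forTo 14 (reg 0 * reg 0) (.store 1 (reg 14) (get 0 (reg 14))))
    (.seq (.assign 1 (reg 0)) (.seq sumMasks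
      (.assign 0 (reg 23 / (reg 3 - reg 3 / reg 2 * reg 2)))))))))

/-- The bound on the number of bits. -/
def bitBound (k n : ℕ) : ℕ := 10 * (n + k + 1) ^ 3

lemma modulus_le (k n : ℕ) : (4 * (n + 1)) ^ k ≤ 2 ^ ((n + 2) * k) := by
  rw [pow_mul]
  refine Nat.pow_le_pow_left ?_ k
  have : n + 1 ≤ 2 ^ n := Nat.lt_two_pow_self
  calc 4 * (n + 1) ≤ 4 * 2 ^ n := Nat.mul_le_mul_left _ this
    _ = 2 ^ (n + 2) := by ring

/-- The host size `m` is separate from `n` because both runs, with `m = n` and with `m = k`, share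
the modulus and the bit bound. -/
lemma fits {m : ℕ} (hk : 0 < k) (hkm : k ≤ m) (hmn : m ≤ n) :
    Fits k m ((4 * (n + 1)) ^ k) (bitBound k n) := by
  set q := n + k + 1 with hq
  set a := (n + 2) * k with ha
  have hM := modulus_le k n
  have haq : a ≤ 2 * q ^ 2 := by
    rw [ha, sq]
    nlinarith
  have hb : bitBound k n = 10 * q ^ 3 := rfl
  have hq1 : 1 ≤ q := by omega
  have hq2 : q ≤ q ^ 2 := Nat.le_self_pow (by norm_num) _
  have hq3 : q ^ 2 ≤ q ^ 3 := Nat.pow_le_pow_right hq1 (by norm_num)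
  have hmq : m < q := by omega
  have hkq : k < q := by omega
  refine ⟨by omega, hkm, ?_, ?_, by positivity, ?_, ?_⟩
  · omega
  · calc k ^ 2 < (2 ^ k) ^ 2 := Nat.pow_lt_pow_left Nat.lt_two_pow_self (by norm_num)
      _ = 2 ^ (k * 2) := by rw [pow_mul]
      _ ≤ 2 ^ bitBound k n := Nat.pow_le_pow_right (by norm_num) (by omega)
  · calc _ ≤ (2 ^ a) ^ m := Nat.pow_le_pow_left hM m
      _ = 2 ^ (a * m) := by rw [pow_mul 2 a m]
      _ < 2 ^ bitBound k n := Nat.pow_lt_pow_right (by norm_num) ?_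
    have : a * m ≤ 2 * q ^ 2 * q := Nat.mul_le_mul haq hmq.le
    have : 2 * q ^ 2 * q = 2 * q ^ 3 := by ring
    omega
  · calc _ ≤ (2 ^ m * 2 ^ a) ^ k :=
          Nat.pow_le_pow_left (Nat.mul_le_mul Nat.lt_two_pow_self.le hM) k
      _ = 2 ^ ((m + a) * k) := by rw [← pow_add, pow_mul]
      _ < 2 ^ bitBound k n := Nat.pow_lt_pow_right (by norm_num) ?_
    have : (m + a) * k ≤ (3 * q ^ 2) * q := Nat.mul_le_mul (by omega) hkq.le
    have : 3 * q ^ 2 * q = 3 * q ^ 3 := by ring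
    omega

lemma maskWeight_le {m r : ℕ} (hk : 0 < k) (hkm : k ≤ m) (hr : r ≤ k / 2) :
    maskWeight m k r ≤ 2 ^ (m + 1) := by
  have h1 : (m - k + r).choose r ≤ 2 ^ m :=
    (Nat.choose_le_two_pow _ _).trans (Nat.pow_le_pow_right (by norm_num) (by omega))
  have h2 : (if r = 0 then 0 else (m - k + (r - 1)).choose (r - 1)) ≤ 2 ^ m := by
    split_ifs
    · simp
    · exact (Nat.choose_le_two_pow _ _).trans (Nat.pow_le_pow_right (by norm_num) (by omega))
  have h3 : 1 - k % 2 ≤ 1 := by omega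
  rw [maskWeight, pow_succ]
  nlinarith

/-- The sum is accumulated without reduction. The exponent of `M` in a term is at most `m + k`, and
`M` itself has quadratically many bits, hence the cubic `bitBound`. -/
lemma maskSum_lt {m : ℕ} (T : SimpleGraph (Fin k)) (H : SimpleGraph (Fin m)) (hk : 0 < k)
    (hkm : k ≤ m) (hmn : m ≤ n) :
    maskSum T H ((4 * (n + 1)) ^ k - 1) < 2 ^ bitBound k n := by
  set M := (4 * (n + 1)) ^ k with hMdef
  set q := n + k + 1 with hq
  set a := (n + 2) * k with ha
  have hM : M ≤ 2 ^ a := modulus_le k n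
  have hM0 : 0 < M := by positivity
  have haq : a ≤ 2 * q ^ 2 := by
    rw [ha, sq]
    nlinarith
  have hb : bitBound k n = 10 * q ^ 3 := rfl
  have hq1 : 1 ≤ q := by omega
  have hq2 : q ≤ q ^ 2 := Nat.le_self_pow (by norm_num) _
  have hq3 : q ^ 2 ≤ q ^ 3 := Nat.pow_le_pow_right hq1 (by norm_num)
  have hmq : m < q := by omega
  have hkq : k < q := by omega
  have hterm : ∀ x ∈ range (2 ^ m), maskTerm T H M x ≤
      2 ^ (a * m) * 2 ^ (m + 1) * 2 ^ ((m + a) * k) := by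
    intro x hx
    rw [maskTerm]
    split_ifs with h
    · refine Nat.mul_le_mul (Nat.mul_le_mul ?_ (maskWeight_le hk hkm (by omega))) ?_
      · calc (M - 1) ^ binaryOnes x ≤ M ^ binaryOnes x := Nat.pow_le_pow_left (Nat.sub_le _ _) _
          _ ≤ M ^ m := Nat.pow_le_pow_right hM0 (binaryOnes_le_of_lt_two_pow (mem_range.1 hx))
          _ ≤ (2 ^ a) ^ m := Nat.pow_le_pow_left hM m
          _ = 2 ^ (a * m) := by rw [pow_mul 2 a m]
      · calc _ ≤ (m * M) ^ k := homSum_maskValue_le hM0 x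
          _ ≤ (2 ^ m * 2 ^ a) ^ k :=
            Nat.pow_le_pow_left (Nat.mul_le_mul Nat.lt_two_pow_self.le hM) k
          _ = 2 ^ ((m + a) * k) := by rw [← pow_add, pow_mul]
    · exact Nat.zero_le _
  rw [maskSum_eq_sum_maskTerm]
  calc _ ≤ ∑ _x ∈ range (2 ^ m), 2 ^ (a * m) * 2 ^ (m + 1) * 2 ^ ((m + a) * k) := sum_le_sum hterm
    _ = 2 ^ (m + (a * m + (m + 1) + (m + a) * k)) := by
      rw [sum_const, card_range, smul_eq_mul]; simp only [pow_add]
    _ < 2 ^ bitBound k n := Nat.pow_lt_pow_right (by norm_num) ?_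
  have h1 : a * m ≤ 2 * q ^ 2 * q := Nat.mul_le_mul haq hmq.le
  have h2 : (m + a) * k ≤ (3 * q ^ 2) * q := Nat.mul_le_mul (by omega) hkq.le
  have h3 : 2 * q ^ 2 * q = 2 * q ^ 3 := by ring
  have h4 : 3 * q ^ 2 * q = 3 * q ^ 3 := by ring
  omega

lemma labelledCopyCount_lt_modulus {m : ℕ} (T : SimpleGraph (Fin k)) (H : SimpleGraph (Fin m))
    (hk : 0 < k) (hmn : m ≤ n) :
    4 ^ (k / 2) * H.labelledCopyCount T < (4 * (n + 1)) ^ k := by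
  have h1 := labelledCopyCount_le T H
  have h2 : m ^ k < (n + 1) ^ k := Nat.pow_lt_pow_left (by omega) hk.ne'
  have h3 : 4 ^ (k / 2) ≤ 4 ^ k := Nat.pow_le_pow_right (by norm_num) (by omega)
  rw [mul_pow]
  calc _ ≤ 4 ^ k * H.labelledCopyCount T := Nat.mul_le_mul_right _ h3
    _ < _ := Nat.mul_lt_mul_of_pos_left (h1.trans_lt h2) (by positivity)

lemma copyCount_eq_zero_of_lt (h : n < k) : G.copyCount T = 0 := by
  rw [SimpleGraph.copyCount_eq_zero]
  rintro ⟨f⟩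
  have := Fintype.card_le_of_injective f f.injective
  simp at this
  omega

lemma sub_div_mul_eq_mod (a b : ℕ) : a - a / b * b = a % b := by
  have := Nat.div_add_mod' a b
  omega

lemma setModulus_spec (hk : 0 < k) (hkn : k ≤ n) (hs : HasInput T G s) :
    Runs (bitBound k n) setModulus s (3 * k + 3) fun s' => s'.reg 2 = (4 * (n + 1)) ^ k := by
  have hF := fits hk hkn (le_refl n)
  have hL := hF.pos
  refine (Runs.assign_seq (N := k * (1 + 2) + 2) hL (by simpa using Nat.one_lt_two_pow hL.ne')
    ?_).mono (by omega) (fun _ _ h => h)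
  refine (Runs.forTo hL (m := k) (N := 1) (fun j s' => s'.reg 2 = (4 * (n + 1)) ^ j)
    (by have := hF.n_lt; omega) ?_ (by simp) ?_).mono le_rfl (fun _ _ h => h.1)
  · intro s' h
    have := h.reg 0 (by decide)
    simpa [hs.reg0] using this
  · intro j hj s' h h9 h2
    have h1 := h.reg 1 (by decide)
    simp [hs.reg1] at h1
    refine Runs.assign hL ?_ (by simp [h2, h9, h1, pow_succ])
    simp only [Expr.val_mul, Expr.val_add, Expr.val_reg, Expr.val_lit, h2, h1, ← pow_succ]
    exact (Nat.pow_le_pow_right (by omega) hj).trans_lt hF.M_lt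

lemma countCopies_spec (hT : T.IsTree) (hs : HasInput T G s) :
    Runs (bitBound k n) countCopies s (240 * (n + k + 1) ^ 5 * downChoose n (k / 2)) fun s' =>
      s'.reg 0 = G.copyCount T := by
  have hk : 0 < k := by
    obtain ⟨u⟩ := hT.connected.nonempty
    exact Nat.zero_lt_of_lt u.2
  have hL : 0 < bitBound k n := by simp only [bitBound]; positivity
  set q := n + k with hq
  set D := downChoose n (k / 2) with hD
  have hD0 : 0 < D := downChoose_pos _ _
  have hpos : 0 < (q + 1) ^ 5 * D := by positivity
  rw [mul_assoc]
  have htime : (3 * k + 3) + (110 * ((q + 1) ^ 5 * D) + (((3 * k ^ 2 + 2) +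
      ((110 * ((q + 1) ^ 5 * D) + 1) + 1)) + 1)) + 1 ≤ 240 * ((q + 1) ^ 5 * D) := by
    have h1 : (q + 1) ^ 2 ≤ (q + 1) ^ 5 := Nat.pow_le_pow_right (by omega) (by norm_num)
    have h2 : (q + 1) ^ 5 ≤ (q + 1) ^ 5 * D := Nat.le_mul_of_pos_right _ hD0
    have h3 : 3 * k + 3 * k ^ 2 + 10 ≤ 10 * (q + 1) ^ 2 := by nlinarith
    omega
  refine (Runs.cond hL (fun h => ?_) (fun h => ?_)).mono htime (fun _ _ h => h)
  · simp [hs.reg0, hs.reg1] at h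
    refine (Runs.assign hL (by simp) ?_).mono (by omega) (fun _ _ h => h)
    simp [copyCount_eq_zero_of_lt (by omega : n < k)]
  simp [hs.reg0, hs.reg1] at h
  have hkn : k ≤ n := by omega
  have hF := fits hk hkn (le_refl n)
  have hF' := fits hk (le_refl k) hkn
  set M := (4 * (n + 1)) ^ k with hM
  refine Runs.seq (setModulus_spec hk hkn hs) fun s₁ h1 e2 => ?_
  have hs₁ := hs.of_agree h1 (by decide) (by decide) (by decide) (by decide)
  refine Runs.seq ((sumMasks_spec hT hF (maskSum_lt T G hk hkn le_rfl) hs₁ e2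
    (q := q) (by omega)).mono (by rw [mul_assoc]) (fun _ _ h => h)) fun s₂ h2 e3 => ?_
  have hs₂ := hs₁.of_agree h2 (by decide) (by decide) (by decide) (by decide)
  have e2₂ := (h2.reg 2 (by decide)).trans e2
  have hG : s₂.reg 3 - s₂.reg 3 / s₂.reg 2 * s₂.reg 2 = 4 ^ (k / 2) * G.labelledCopyCount T := by
    rw [sub_div_mul_eq_mod, e3, e2₂]
    exact maskSum_mod hkn T G (labelledCopyCount_lt_modulus T G hk le_rfl)
  have hGM := labelledCopyCount_lt_modulus T G hk (le_refl n)
  have hML := hF.M_lt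
  refine Runs.assign_seq hL (by simp only [Expr.val_sub, Expr.val_mul, Expr.val_div, Expr.val_reg, hG]; omega) ?_
  simp only [Expr.val_sub, Expr.val_mul, Expr.val_div, Expr.val_reg, hG]
  set s₃ := s₂.setReg 23 (4 ^ (k / 2) * G.labelledCopyCount T) with hs₃
  have hk2 : k * k < 2 ^ bitBound k n := by have := hF.k_sq; rwa [sq] at this
  refine Runs.seq (N₁ := 3 * k ^ 2 + 2) ((Runs.forTo hL (m := k * k) (N := 1)
    (fun j s' => ∀ i < j, s'.arr 1 i = s.arr 0 i) hk2 ?_ (by simp) ?_).mono ?_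
    (fun _ _ h => h.1)) fun s₄ h4 hcopy => ?_
  · intro s' h
    have := h.reg 0 (by decide)
    simp [hs₃, hs₂.reg0] at this
    simp [this]
  · intro j hj s' h h14 hI
    have a0 := h.arr 0 (by decide)
    simp [hs₃, h2.arr 0 (by decide), h1.arr 0 (by decide)] at a0
    refine Runs.of_bounded fun hb => Runs.store hL (by simpa using hb.2 _ _) ?_
    refine ⟨by simpa using h14, fun i hi => ?_⟩
    simp only [State.arr_setReg, State.arr_setArr, Expr.val_reg, Expr.val_get, h14, a0, true_and]
    split_ifs with hij
    · rw [hij]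
    · exact hI i (by omega)
  · rw [sq]; omega
  have e0 := h4.reg 0 (by decide)
  have e2₄ := h4.reg 2 (by decide)
  have e23 := h4.reg 23 (by decide)
  have a0 := h4.arr 0 (by decide)
  simp [hs₃, hs₂.reg0, e2₂] at e0 e2₄ e23 a0
  refine Runs.assign_seq hL (by simp [e0]; have := hF.n_lt; omega) ?_
  simp only [Expr.val_reg, e0]
  set s₅ := s₄.setReg 1 k with hs₅
  have hs₅I : HasInput T T s₅ := by
    refine ⟨by simp [hs₅, e0], by simp [hs₅], fun u v => ?_, fun u v => ?_⟩
    · simp only [hs₅, State.arr_setReg, a0]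
      exact hs₂.arr0 u v
    · simp only [hs₅, State.arr_setReg]
      rw [hcopy _ (by nlinarith [u.2, v.2])]
      exact hs.arr0 u v
  have hDk : downChoose k (k / 2) ≤ D := downChoose_mono_left hkn _
  refine Runs.seq ((sumMasks_spec hT hF' (maskSum_lt T T hk le_rfl hkn) hs₅I (by simp [hs₅, e2₄, hM])
    (q := q) (by omega)).mono (by rw [mul_assoc]; exact Nat.mul_le_mul_left _ (Nat.mul_le_mul_left _ hDk))
    (fun _ _ h => h)) fun s₆ h6 e3' => ?_
  have e2₆ := h6.reg 2 (by decide)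
  have e23₆ := h6.reg 23 (by decide)
  simp [hs₅, e2₄, e23] at e2₆ e23₆
  have hTT : s₆.reg 3 - s₆.reg 3 / s₆.reg 2 * s₆.reg 2 = 4 ^ (k / 2) * T.labelledCopyCount T := by
    rw [sub_div_mul_eq_mod, e3', e2₆]
    exact maskSum_mod le_rfl T T (labelledCopyCount_lt_modulus T T hk hkn)
  have hquot : 4 ^ (k / 2) * G.labelledCopyCount T / (4 ^ (k / 2) * T.labelledCopyCount T) =
      G.copyCount T := by
    rw [Nat.mul_div_mul_left _ _ (by positivity), labelledCopyCount_eq_copyCount_mul]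
    exact Nat.mul_div_cancel _ (SimpleGraph.labelledCopyCount_pos.2 (SimpleGraph.IsContained.refl T))
  refine Runs.assign hL ?_ ?_
  · simp only [Expr.val_sub, Expr.val_mul, Expr.val_div, Expr.val_reg, hTT, e23₆]
    exact (Nat.div_le_self _ _).trans_lt (by omega)
  · simp only [Expr.val_sub, Expr.val_mul, Expr.val_div, Expr.val_reg, hTT, e23₆, hquot,
      State.reg_setReg, if_true]

open Classical in
lemma adjTable_apply {m : ℕ} (H : SimpleGraph (Fin m)) (u v : Fin m) :
    adjTable H (u * m + v) = if H.Adj u v then 1 else 0 := by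
  rw [adjTable]
  refine if_congr ⟨?_, fun h => ⟨u, v, h, rfl⟩⟩ rfl rfl
  rintro ⟨a, b, hab, h⟩
  obtain ⟨h1, h2⟩ := (mul_add_inj v.2 b.2).1 h
  rwa [Fin.ext h1, Fin.ext h2]

lemma hasInput_graphPairInput (T : SimpleGraph (Fin k)) (G : SimpleGraph (Fin n)) :
    HasInput T G (graphPairInput T G) :=
  ⟨rfl, rfl, adjTable_apply T, adjTable_apply G⟩

lemma bounded_graphPairInput (T : SimpleGraph (Fin k)) (G : SimpleGraph (Fin n)) :
    Bounded (bitBound k n) (graphPairInput T G) := by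
  have h : n + k + 1 < 2 ^ bitBound k n := by
    refine lt_of_le_of_lt ?_ Nat.lt_two_pow_self
    have := Nat.le_self_pow (show 3 ≠ 0 by norm_num) (n + k + 1)
    simp only [bitBound]
    omega
  have hadj : ∀ {m : ℕ} (H : SimpleGraph (Fin m)) (i : ℕ), adjTable H i ≤ 1 := by
    intro m H i
    rw [adjTable]
    split_ifs <;> simp
  refine ⟨fun x => ?_, fun a i => ?_⟩
  · simp only [graphPairInput]
    split_ifs <;> omega
  · have h1 := hadj T i
    have h2 := hadj G i
    simp only [graphPairInput]
    split_ifs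
    · omega
    · omega
    · positivity

end RAM

theorem mainTheorem4 :
    ∃ (P : RAM.Prog) (C d : ℕ),
      ∀ (k n : ℕ) (T : SimpleGraph (Fin k)) (G : SimpleGraph (Fin n)), T.IsTree →
        ∃ (t : ℕ) (s : RAM.State),
          RAM.Exec P (RAM.graphPairInput T G) t s ∧
          s.reg 0 = G.copyCount T ∧
          t ≤ C * (n + k + 1) ^ d * downChoose n (k / 2) := by
  -- The step count `240 * (n + k + 1) ^ 5` times the bit bound `10 * (n + k + 1) ^ 3` gives the
  -- constant and the exponent.
  refine ⟨RAM.countCopies, 2400 * RAM.countCopies.charge, 8, fun k n T G hT => ?_⟩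
  obtain ⟨t, s, h1, h2, -, h3⟩ := RAM.countCopies_spec hT (RAM.hasInput_graphPairInput T G)
    (RAM.bounded_graphPairInput T G)
  refine ⟨t, s, h1, h3, h2.trans_eq ?_⟩
  rw [RAM.bitBound]
  ring
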